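/- **Setting.** Let $\omega(p)=|p|$ for $p\in\mathbb R^3$, let $\mathcal H=L^2(\mathbb R^3,\tfrac{dp}{2\omega};\mathbb C^3)$ with inner product antilinear in the first argument, and let $P(p)z=z-\frac{p\,(p\cdot z)}{|p|^2}$ be the transverse projection. Let $\mathcal H_T=P\mathcal H$, let $\mathcal F(\mathcal H_T)=\bigoplus_{n\ge 0}\mathrm{Sym}^n\mathcal H_T$ be the Fock space over $\mathcal H_T$ with vacuum $\Omega_0$, and let $a^*_{in}(h)$, $a_{in}(h)$ be its creation and annihilation operators on the finite particle vectors. Let $\mathcal S\subset\mathcal H_T$ be the subspace of rapidly decreasing functions: for every $k\ge 0$ there is $C$ with $|h(p)|\le C(1+|p|^2)^{-k}$. For a trajectory $x:\mathbb R\to\mathbb R^3$ put $$J(p)=-i(2\pi)^{-3/2}\int x'(s)\,e^{i(\omega s-p\cdot x(s))}\,ds,\qquad J_T(p)=P(p)J(p),\qquad (J_T,h)=\int\overline{J_T(p)}\cdot h(p)\,\frac{dp}{2\omega}\quad(h\in\mathcal S),$$ $$a^*_{out}(h)=a^*_{in}(h)-(J_T,h),\qquad a_{out}(h)=a_{in}(h)-\overline{(J_T,h)},$$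 $$A_{in/out}(h)=\tfrac1{\sqrt2}\big(a^*_{in/out}(h)+a_{in/out}(h)\big),\qquad W_{in/out}(h)=e^{iA_{in/out}(h)} .$$ Let $\mathfrak A$ be the $C^*$-algebra of bounded operators on $\mathcal F(\mathcal H_T)$ generated by the $W_{in}(h)$, $h\in\mathcal S$, let $\omega_{in}(B)=(\Omega_0,B\Omega_0)$, and let $\omega_{out}=\omega_{in}\circ\alpha$, where $\alpha$ is the $*$-automorphism of $\mathfrak A$ with $\alpha(W_{out}(h))=W_{in}(h)$ for all $h\in\mathcal S$. A state on $\mathfrak A$ is a *Fock state* if it is of the form $B\mapsto\sum_n(\Psi_n,B\Psi_n)$ with $\Psi_n\in\mathcal F(\mathcal H_T)$ and $\sum_n\|\Psi_n\|^2=1$ (that is, if it is given by a density operator on Fock space; in particular a unit vector defines a Fock state). **Proposition.** Let $x:\mathbb R\to\mathbb R^3$ be continuous and $C^3$ on each of $(-\infty,0]$ and $[0,\infty)$ (one-sidedly at $0$), with $v^-:=x'(0^-)\ne x'(0^+)=:v^+$. Suppose that $x'$ has compact support and that $|x'(t)|\le v_0<1$ for $t\neq 0$. Then: 1. $J_T\notin\mathcal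 H_T$. 2. The automorphism $\alpha$ exists (every $W_{out}(h)$, $h\in\mathcal S$, lying in $\mathfrak A$) and is unique, and $\omega_{out}$ is not a Fock state. 3. The divergence is ultraviolet: $\int_{|p|\le R}|J_T(p)|^2\,\frac{dp}{2\omega}<\infty$ for every $R$. For large $p$ it is that of the boundary term at $t=0$: the difference of $J_T(p)$ and $$-(2\pi)^{-3/2}\,e^{-ip\cdot x(0)}\,P(p)\left[\frac{v^-}{\omega-p\cdot v^-}-\frac{v^+}{\omega-p\cdot v^+}\right]$$ is square integrable on $\{|p|\ge 1\}$ with respect to $\frac{dp}{2\omega}$. -/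

import Mathlib

open MeasureTheory
open scoped InnerProductSpace TensorProduct ENNReal

noncomputable section

/-! ## Fock space over a complex Hilbert space -/

namespace Fock

/-- A bundled complex Hilbert space (used only to define tensor powers by recursion). -/
structure Hilb : Type 1 where
  carrier : Type
  [normed : NormedAddCommGroup carrier]
  [inner : InnerProductSpace ℂ carrier]
  [complete : CompleteSpace carrier]

attribute [instance] Hilb.normed Hilb.inner Hilb.complete

variable (H : Type) [NormedAddCommGroup H] [InnerProductSpace ℂ H]

/-- The Hilbert space tensor powers: `H^{⊗0} = ℂ` and `H^{⊗(n+1)}` is the completion of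
`H ⊗ H^{⊗n}`. -/
def tensorHilb : ℕ → Hilb
  | 0 => ⟨ℂ⟩
  | n + 1 => ⟨UniformSpace.Completion (H ⊗[ℂ] (tensorHilb n).carrier)⟩

/-- The `n`-fold Hilbert space tensor power of `H`. -/
abbrev TensorPow (n : ℕ) : Type := (tensorHilb H n).carrier

variable {H}

/-- `ψ ↦ h ⊗ ψ` from `H^{⊗n}` to `H^{⊗(n+1)}`. -/
def tensorLeft (h : H) (n : ℕ) : TensorPow H n →L[ℂ] TensorPow H (n + 1) :=
  (UniformSpace.Completion.toComplL : H ⊗[ℂ] TensorPow H n →L[ℂ]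
    UniformSpace.Completion (H ⊗[ℂ] TensorPow H n)).comp
      (TensorProduct.mkL ℂ H (TensorPow H n) h)

/-- The element `h ⊗ h ⊗ ⋯ ⊗ h` of `H^{⊗n}`. -/
def diagPow (h : H) : (n : ℕ) → TensorPow H n
  | 0 => (1 : ℂ)
  | n + 1 => tensorLeft h n (diagPow h n)

variable (H)

/-- The symmetric tensors: the closed linear span of the `h ⊗ ⋯ ⊗ h` in `H^{⊗n}`. -/
def symmSubspace (n : ℕ) : Submodule ℂ (TensorPow H n) :=
  (Submodule.span ℂ (Set.range fun h : H => diagPow h n)).topologicalClosure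

instance symmSubspace_complete (n : ℕ) : CompleteSpace (symmSubspace H n) :=
  (Submodule.isClosed_topologicalClosure _).completeSpace_coe

/-- The `n`-particle space `Sym^n H` as a Hilbert space. -/
def symmHilb (n : ℕ) : Hilb := ⟨symmSubspace H n⟩

/-- The `n`-particle space: the symmetric tensors in `H^{⊗n}`. -/
abbrev NParticle (n : ℕ) : Type := (symmHilb H n).carrier

/-- The inclusion of the `n`-particle space in `H^{⊗n}`. -/
def incl (n : ℕ) : NParticle H n →L[ℂ] TensorPow H n := (symmSubspace H n).subtypeL

/-- The orthogonal projection of `H^{⊗n}` onto the symmetric tensors. -/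
def symmProj (n : ℕ) : TensorPow H n →L[ℂ] NParticle H n :=
  (symmSubspace H n).orthogonalProjectionOnto

/-- The Fock space `⨁ₙ Sym^n H` (Hilbert space direct sum). -/
abbrev Space : Type := lp (fun n : ℕ => NParticle H n) 2

/-- The finite particle vectors `𝒟`. -/
def FiniteParticle : Submodule ℂ (Space H) where
  carrier := {ψ | {n : ℕ | ψ n ≠ 0}.Finite}
  zero_mem' := by simp
  add_mem' := by
    intro a b ha hb
    refine (Set.Finite.union ha hb).subset fun n hn => ?_
    by_contra hc
    simp only [Set.mem_union, Set.mem_ofPred_eq, not_or, not_not] at hc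
    exact hn (by simp [hc.1, hc.2])
  smul_mem' := by
    intro c a ha
    refine Set.Finite.subset ha fun n hn hc => hn ?_
    simp [hc]

variable {H}

/-- A sequence of `n`-particle vectors with finitely many nonzero terms, as an element of `𝒟`. -/
def mkFinite (f : ∀ n : ℕ, NParticle H n) (hf : {n | f n ≠ 0}.Finite) : FiniteParticle H :=
  ⟨⟨f, (memℓp_zero hf).of_exponent_ge bot_le⟩, hf⟩

/-- Creation on `n`-particle vectors: `ψ ↦ √(n+1) P_sym (h ⊗ ψ)`. -/
def createN (h : H) (n : ℕ) : NParticle H n →L[ℂ] NParticle H (n + 1) :=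
  ((Real.sqrt (n + 1) : ℝ) : ℂ) •
    (symmProj H (n + 1)).comp ((tensorLeft h n).comp (incl H n))

/-- Annihilation on `(n+1)`-particle vectors: the adjoint of `createN h n`. -/
def annihilateN (h : H) (n : ℕ) : NParticle H (n + 1) →L[ℂ] NParticle H n :=
  ContinuousLinearMap.adjoint (createN h n)

/-- The components of `a^*(h) ψ`. -/
def createFun (h : H) (ψ : ∀ n : ℕ, NParticle H n) : ∀ n : ℕ, NParticle H n
  | 0 => 0
  | n + 1 => createN h n (ψ n)

/-- The creation operator `a^*(h)` on `𝒟`. -/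
def create (h : H) : FiniteParticle H →ₗ[ℂ] FiniteParticle H where
  toFun ψ := mkFinite (createFun h (ψ : Space H)) (by
    refine (ψ.2.image Nat.succ).subset fun n hn => ?_
    cases n with
    | zero => exact absurd rfl hn
    | succ n =>
      refine ⟨n, fun hc => hn ?_, rfl⟩
      change createN h n ((ψ : Space H) n) = 0
      rw [hc, map_zero])
  map_add' ψ φ := by
    refine Subtype.ext (lp.ext (funext fun n => ?_))
    cases n with
    | zero => exact (add_zero (0 : NParticle H 0)).symm
    | succ n => exact map_add (createN h n) _ _
  map_smul' c ψ := by
    refine Subtype.ext (lp.ext (funext fun n => ?_))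
    cases n with
    | zero => exact (smul_zero (A := NParticle H 0) c).symm
    | succ n => exact map_smul (createN h n) c _

/-- The annihilation operator `a(h)` on `𝒟`. -/
def annihilate (h : H) : FiniteParticle H →ₗ[ℂ] FiniteParticle H where
  toFun ψ := mkFinite (fun n => annihilateN h n ((ψ : Space H) (n + 1))) (by
    refine (ψ.2.preimage (Nat.succ_injective.injOn)).subset fun n hn => fun hc => hn ?_
    rw [show (ψ : Space H) (n + 1) = 0 from hc, map_zero])
  map_add' ψ φ := by
    refine Subtype.ext (lp.ext (funext fun n => ?_))
    exact map_add (annihilateN h n) _ _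
  map_smul' c ψ := by
    refine Subtype.ext (lp.ext (funext fun n => ?_))
    exact map_smul (annihilateN h n) c _

variable (H) in
/-- The Fock vacuum `Ω₀ = (1, 0, 0, …)`. -/
def vacuum : Space H :=
  lp.single 2 0 (symmProj H 0 (1 : ℂ))

/-- `IsExpI A U`: the bounded operator `U` is given on every vector of `𝒟` by the exponential
series `∑ₖ (i A)^k ψ / k!`.  As `𝒟` is dense, there is at most one such `U`. -/
def IsExpI (A : Module.End ℂ (FiniteParticle H)) (U : Space H →L[ℂ] Space H) : Prop :=
  ∀ ψ : FiniteParticle H, HasSum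
    (fun k : ℕ => (Complex.I ^ k / (k.factorial : ℂ)) • (((A ^ k) ψ : FiniteParticle H) : Space H)) (U ψ)

open Classical in
/-- The bounded operator `e^{iA}` on Fock space, for `A` on `𝒟` as in `IsExpI`.  For the field
operators (symmetric, with the vectors of `𝒟` as entire analytic vectors) it is the unitary
exponential of the self-adjoint closure of `A`. -/
def expI (A : Module.End ℂ (FiniteParticle H)) : Space H →L[ℂ] Space H :=
  if h : ∃ U, IsExpI A U then h.choose else 0

end Fock

/-! ## The photon field in the Coulomb gauge with a point source -/

namespace PointSource

/-- Position and momentum space `ℝ³`. -/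
abbrev R3 : Type := EuclideanSpace ℝ (Fin 3)

/-- The complex vectors `ℂ³`. -/
abbrev C3 : Type := EuclideanSpace ℂ (Fin 3)

/-- The measure `dp / 2ω` on momentum space, `ω(p) = |p|`. -/
def photonMeasure : Measure R3 :=
  volume.withDensity fun p => ENNReal.ofReal (2 * ‖p‖)⁻¹

/-- The Hilbert space `ℋ = L²(ℝ³, dp / 2ω; ℂ³)`. -/
abbrev OneParticle : Type := Lp C3 2 photonMeasure

/-- The transverse projection `P(p)` on `ℂ³`, `(P(p) z)_j = ∑ₖ (δ_{jk} - p_j p_k / |p|²) z_k`. -/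
def transverse (p : R3) : C3 →ₗ[ℂ] C3 where
  toFun z := WithLp.toLp 2 fun j =>
    ∑ k, (((if j = k then 1 else 0) - p j * p k / ‖p‖ ^ 2 : ℝ) : ℂ) * z k
  map_add' z w := by
    ext j
    simp [mul_add, Finset.sum_add_distrib]
  map_smul' c z := by
    ext j
    simp only [PiLp.smul_apply, smul_eq_mul, RingHom.id_apply, Finset.mul_sum]
    exact Finset.sum_congr rfl fun k _ => by ring

/-- The one photon space `ℋ_T = P ℋ`: the range of the projection `P`, that is, the elements
of `ℋ` which `P` leaves fixed. -/
def HT : Submodule ℂ OneParticle where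
  carrier := {h | ∀ᵐ p ∂photonMeasure, transverse p (h p) = h p}
  zero_mem' := by
    filter_upwards [Lp.coeFn_zero C3 2 photonMeasure] with p hp
    rw [hp, Pi.zero_apply, map_zero]
  add_mem' := by
    intro a b ha hb
    filter_upwards [ha, hb, Lp.coeFn_add a b] with p h1 h2 h3
    rw [h3, Pi.add_apply, map_add, h1, h2]
  smul_mem' := by
    intro c a ha
    filter_upwards [ha, Lp.coeFn_smul c a] with p h1 h2
    rw [h2, Pi.smul_apply, map_smul, h1]

/-- The domain `𝒮 ⊂ ℋ_T` of rapidly decreasing functions. -/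
def S : Submodule ℂ HT where
  carrier := {h | ∀ k : ℕ, ∃ C : ℝ, ∀ᵐ p ∂photonMeasure,
    ‖(h : OneParticle) p‖ ≤ C * ((1 + ‖p‖ ^ 2) ^ k)⁻¹}
  zero_mem' := by
    intro k
    refine ⟨0, ?_⟩
    filter_upwards [Lp.coeFn_zero C3 2 photonMeasure] with p hp
    rw [Submodule.coe_zero, hp, Pi.zero_apply, norm_zero, zero_mul]
  add_mem' := by
    intro a b ha hb k
    obtain ⟨C, hC⟩ := ha k
    obtain ⟨D, hD⟩ := hb k
    refine ⟨C + D, ?_⟩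
    filter_upwards [hC, hD, Lp.coeFn_add (a : OneParticle) (b : OneParticle)] with p h1 h2 h3
    rw [Submodule.coe_add, h3, Pi.add_apply, add_mul]
    exact (norm_add_le _ _).trans (add_le_add h1 h2)
  smul_mem' := by
    intro c a ha k
    obtain ⟨C, hC⟩ := ha k
    refine ⟨‖c‖ * C, ?_⟩
    filter_upwards [hC, Lp.coeFn_smul c (a : OneParticle)] with p h1 h2
    rw [Submodule.coe_smul, h2, Pi.smul_apply, norm_smul, mul_assoc]
    exact mul_le_mul_of_nonneg_left h1 (norm_nonneg c)

/-- The photon Fock space `ℱ(ℋ_T)`. -/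
abbrev PhotonFock : Type := Fock.Space HT

/-- A real vector regarded as a complex vector. -/
def complexify (v : R3) : C3 := WithLp.toLp 2 fun k => ((v k : ℝ) : ℂ)

/-- The phase `ψ(p,t) = ω t - p · x(t)`. -/
def phase (x : ℝ → R3) (p : R3) (t : ℝ) : ℝ := ‖p‖ * t - ⟪p, x t⟫_ℝ

/-- `J(p) = -i (2π)^{-3/2} ∫ x'(s) e^{i(ω s - p·x(s))} ds` for the trajectory `x`. -/
def J (x : ℝ → R3) (p : R3) : C3 :=
  (-Complex.I * (((2 * Real.pi) ^ (-(3 / 2) : ℝ) : ℝ) : ℂ)) •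
    ∫ s : ℝ, Complex.exp (Complex.I * (phase x p s : ℂ)) • complexify (deriv x s)

/-- The transverse part `J_T(p) = P(p) J(p)`. -/
def JT (x : ℝ → R3) (p : R3) : C3 := transverse p (J x p)

/-- The pairing `(J_T, h) = ∫ conj(J_T(p)) · h(p) dp / 2ω` for `h ∈ 𝒮`. -/
def pairing (x : ℝ → R3) (h : S) : ℂ :=
  ∫ p, ⟪JT x p, ((h : HT) : OneParticle) p⟫_ℂ ∂photonMeasure

/-- `a^*_in(h)`. -/
def createIn (h : S) : Module.End ℂ (Fock.FiniteParticle HT) := Fock.create (h : HT)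

/-- `a_in(h)`. -/
def annihilateIn (h : S) : Module.End ℂ (Fock.FiniteParticle HT) := Fock.annihilate (h : HT)

/-- `a^*_out(h) = a^*_in(h) - (J_T, h)`. -/
def createOut (x : ℝ → R3) (h : S) : Module.End ℂ (Fock.FiniteParticle HT) :=
  createIn h - pairing x h • 1

/-- `a_out(h) = a_in(h) - (h, J_T)`. -/
def annihilateOut (x : ℝ → R3) (h : S) : Module.End ℂ (Fock.FiniteParticle HT) :=
  annihilateIn h - (starRingEnd ℂ) (pairing x h) • 1

/-- The momentum space field `A_in(h) = (a^*_in(h) + a_in(h)) / √2`. -/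
def fieldIn (h : S) : Module.End ℂ (Fock.FiniteParticle HT) :=
  (((Real.sqrt 2)⁻¹ : ℝ) : ℂ) • (createIn h + annihilateIn h)

/-- The momentum space field `A_out(h) = (a^*_out(h) + a_out(h)) / √2`. -/
def fieldOut (x : ℝ → R3) (h : S) : Module.End ℂ (Fock.FiniteParticle HT) :=
  (((Real.sqrt 2)⁻¹ : ℝ) : ℂ) • (createOut x h + annihilateOut x h)

/-- The Weyl operator `W_in(h) = e^{i A_in(h)}`. -/
def weylIn (h : S) : PhotonFock →L[ℂ] PhotonFock := Fock.expI (fieldIn h)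

/-- The Weyl operator `W_out(h) = e^{i A_out(h)}`. -/
def weylOut (x : ℝ → R3) (h : S) : PhotonFock →L[ℂ] PhotonFock := Fock.expI (fieldOut x h)

/-- The `C*`-algebra `𝔄` of bounded operators generated by the `W_in(h)`, `h ∈ 𝒮`. -/
def weylAlgebra : StarSubalgebra ℂ (PhotonFock →L[ℂ] PhotonFock) :=
  (StarAlgebra.adjoin ℂ (Set.range weylIn)).topologicalClosure

/-- The in state `ω_in = (Ω₀, · Ω₀)` on `𝔄`, given by the Fock vacuum. -/
def stateIn (B : weylAlgebra) : ℂ :=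
  ⟪Fock.vacuum HT, (B : PhotonFock →L[ℂ] PhotonFock) (Fock.vacuum HT)⟫_ℂ

/-- `α` is a `*`-automorphism of `𝔄` with `α(W_out(h)) = W_in(h)` for all `h ∈ 𝒮` (in particular
every `W_out(h)` belongs to `𝔄`). -/
def IsScatteringAut (x : ℝ → R3) (α : weylAlgebra ≃⋆ₐ[ℂ] weylAlgebra) : Prop :=
  ∀ h : S, ∃ hmem : weylOut x h ∈ weylAlgebra,
    (α ⟨weylOut x h, hmem⟩ : PhotonFock →L[ℂ] PhotonFock) = weylIn h

/-- The out state `ω_out = ω_in ∘ α`. -/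
def stateOut (α : weylAlgebra ≃⋆ₐ[ℂ] weylAlgebra) (B : weylAlgebra) : ℂ := stateIn (α B)

/-- `ω` is a Fock state: it is given by a density operator `∑ₙ |Ψₙ⟩⟨Ψₙ|` of trace one on Fock
space (a normalized vector of Fock space being the case of a single nonzero `Ψₙ`). -/
def IsFockState (ω : weylAlgebra → ℂ) : Prop :=
  ∃ Ψ : ℕ → PhotonFock, HasSum (fun n => ‖Ψ n‖ ^ 2) 1 ∧
    ∀ B : weylAlgebra,
      HasSum (fun n => ⟪Ψ n, (B : PhotonFock →L[ℂ] PhotonFock) (Ψ n)⟫_ℂ) (ω B)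

/-- The velocity `x'(0⁻)`. -/
def velMinus (x : ℝ → R3) : R3 := derivWithin x (Set.Iic 0) 0

/-- The velocity `x'(0⁺)`. -/
def velPlus (x : ℝ → R3) : R3 := derivWithin x (Set.Ici 0) 0

/-- The transverse part of the boundary term at `t = 0` in `J`,
`-(2π)^{-3/2} e^{-i p·x(0)} P(p) [v⁻ / (ω - p·v⁻) - v⁺ / (ω - p·v⁺)]` with `v^± = x'(0^±)`. -/
def boundaryT (x : ℝ → R3) (p : R3) : C3 :=
  (-(((2 * Real.pi) ^ (-(3 / 2) : ℝ) : ℝ) : ℂ) * Complex.exp (Complex.I * (phase x p 0 : ℂ))) •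
    transverse p (complexify
      ((‖p‖ - ⟪p, velMinus x⟫_ℝ)⁻¹ • velMinus x - (‖p‖ - ⟪p, velPlus x⟫_ℝ)⁻¹ • velPlus x))

end PointSource

end

noncomputable section

namespace Fock

variable {H : Type} [NormedAddCommGroup H] [InnerProductSpace ℂ H]

/-! ### The canonical commutation relations on `n`-particle vectors -/

/-! The current is bounded in `p` and `1/|p|` is locally integrable on three-space, so `J_T` can
fail to be square integrable only at large momentum. There, two integrations by parts on each side
of `t = 0` give `J` as a boundary term plus `O(|p|⁻²)` (`exists_norm_J_sub_le`). The remainder is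
square integrable at infinity. The norm of the boundary term is homogeneous of degree `-1`, so its
squared norm times the density `1/2|p|` has degree `-3` and gives every dyadic shell the same mass.
This mass is positive, because near a direction orthogonal to both velocities the term does not
vanish (`not_memLp_boundaryT`). Hence `J_T` is not square integrable.

On the algebra, `W_out(h)` is `W_in(h)` times the phase `exp(-i√2 Re(J_T,h))`, so `α` must multiply
each `W_in(h)` by the inverse phase. Were `J_T` in the one photon space, this would be conjugation
by the Weyl operator of `√2 i J_T`. The cutoffs `J_R` of `J_T` to `|p| ≤ R` do lie in `𝒮`.
Conjugation by their Weyl operators converges in norm on each generator, hence, since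
`*`-homomorphisms are contractive, on the whole algebra; the opposite sign gives the inverse
(`existsUnique_starAlgEquiv_of_tendsto`).

A density operator makes `h ↦ ω(W_in(h))` continuous at `0` in the Hilbert norm
(`tendsto_of_isFockState`). For `ω_out` this forces the phase to have positive real part on some
ball of radius `δ`. Testing on `t J_R`, where the pairing is `t ‖J_R‖²`, bounds `‖J_R‖` by `4/δ` for
all `R`, and Fatou's lemma puts `J_T` in `L²`, a contradiction.

The Weyl relations and strong continuity that this uses are derived from the exponential series on
finite particle vectors, where `k` fields grow only like `√k!`. -/

theorem inner_tensorLeft (f g : H) (n : ℕ) (s t : TensorPow H n) :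
    ⟪tensorLeft f n s, tensorLeft g n t⟫_ℂ = ⟪f, g⟫_ℂ * ⟪s, t⟫_ℂ := by
  have h := UniformSpace.Completion.inner_coe (𝕜 := ℂ) (E := H ⊗[ℂ] TensorPow H n)
    (f ⊗ₜ[ℂ] s) (g ⊗ₜ[ℂ] t)
  rw [TensorProduct.inner_tmul] at h
  exact h

theorem norm_tensorLeft (h : H) (n : ℕ) (s : TensorPow H n) :
    ‖tensorLeft h n s‖ = ‖h‖ * ‖s‖ := by
  have h1 := UniformSpace.Completion.norm_coe (E := H ⊗[ℂ] TensorPow H n) (h ⊗ₜ[ℂ] s)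
  rw [TensorProduct.norm_tmul] at h1
  exact h1

theorem tensorLeft_add (f g : H) (n : ℕ) : tensorLeft (f + g) n = tensorLeft f n + tensorLeft g n := by
  unfold tensorLeft
  rw [map_add, ContinuousLinearMap.comp_add]
  rfl

theorem tensorLeft_smul (c : ℂ) (f : H) (n : ℕ) : tensorLeft (c • f) n = c • tensorLeft f n := by
  unfold tensorLeft
  rw [map_smul, ContinuousLinearMap.comp_smul]
  rfl

theorem inner_diagPow (f g : H) (n : ℕ) : ⟪diagPow f n, diagPow g n⟫_ℂ = ⟪f, g⟫_ℂ ^ n := by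
  induction n with
  | zero =>
    change ⟪(1 : ℂ), (1 : ℂ)⟫_ℂ = _
    simp
  | succ n ih =>
    change ⟪tensorLeft f n (diagPow f n), tensorLeft g n (diagPow g n)⟫_ℂ = _
    rw [inner_tensorLeft, ih, pow_succ']

/-- The vector `h ⊗ ⋯ ⊗ h` as an `n`-particle vector. -/
def diagVec (h : H) (n : ℕ) : NParticle H n :=
  (⟨diagPow h n, Submodule.le_topologicalClosure _ (Submodule.subset_span ⟨h, rfl⟩)⟩ :
    symmSubspace H n)

theorem incl_diagVec (h : H) (n : ℕ) : incl H n (diagVec h n) = diagPow h n := rfl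

theorem norm_incl (n : ℕ) (a : NParticle H n) : ‖incl H n a‖ = ‖a‖ := rfl

theorem inner_symmProj (n : ℕ) (a : NParticle H n) (t : TensorPow H n) :
    ⟪a, symmProj H n t⟫_ℂ = ⟪incl H n a, t⟫_ℂ :=
  Submodule.inner_orthogonalProjectionOnto_eq_of_mem_left (K := symmSubspace H n) a t

theorem symmProj_incl (n : ℕ) (a : NParticle H n) : symmProj H n (incl H n a) = a :=
  Submodule.orthogonalProjectionOnto_mem_subspace_eq_self (K := symmSubspace H n) a

theorem norm_symmProj_le (n : ℕ) (t : TensorPow H n) : ‖symmProj H n t‖ ≤ ‖t‖ :=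
  Submodule.norm_orthogonalProjectionOnto_apply_le (symmSubspace H n) t

theorem inner_diagVec (f g : H) (n : ℕ) : ⟪diagVec f n, diagVec g n⟫_ℂ = ⟪f, g⟫_ℂ ^ n :=
  inner_diagPow f g n

/-- Orthogonality to `a - b` is a closed linear condition, and the symmetric tensors are the closed
span of the diagonal powers; so `a - b` is orthogonal to itself. -/
theorem ext_inner_diagVec {n : ℕ} {a b : NParticle H n}
    (h : ∀ f : H, ⟪diagVec f n, a⟫_ℂ = ⟪diagVec f n, b⟫_ℂ) : a = b := by
  have key : ∀ t ∈ symmSubspace H n, ⟪t, incl H n (a - b)⟫_ℂ = 0 := by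
    intro t ht
    have hcl : IsClosed {t : TensorPow H n | ⟪t, incl H n (a - b)⟫_ℂ = 0} :=
      isClosed_eq (by fun_prop) continuous_const
    refine closure_minimal (s := (Submodule.span ℂ (Set.range fun h : H => diagPow h n) :
      Set (TensorPow H n))) ?_ hcl ht
    intro s hs
    simp only [SetLike.mem_coe] at hs
    simp only [Set.mem_ofPred_eq]
    induction hs using Submodule.span_induction with
    | mem x hx =>
      obtain ⟨f, rfl⟩ := hx
      have : ⟪diagVec f n, a - b⟫_ℂ = 0 := by rw [inner_sub_right, h, sub_self]
      exact this
    | zero => exact inner_zero_left _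
    | add x y _ _ hx hy => rw [inner_add_left, hx, hy, add_zero]
    | smul c x _ hx => rw [inner_smul_left, hx, mul_zero]
  have := key (incl H n (a - b)) (a - b : symmSubspace H n).2
  rw [inner_self_eq_zero] at this
  have h0 : a - b = 0 := Subtype.ext this
  exact sub_eq_zero.mp h0

/-- Passing to adjoints reduces this to `ext_inner_diagVec`. Operator identities can thus be checked
on diagonal vectors, where everything is explicit. -/
theorem ext_diagVec {n : ℕ} {E : Type*} [NormedAddCommGroup E] [InnerProductSpace ℂ E]
    [CompleteSpace E]
    {S T : NParticle H n →L[ℂ] E}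
    (h : ∀ f : H, S (diagVec f n) = T (diagVec f n)) : S = T := by
  have key : ∀ e : E, ContinuousLinearMap.adjoint S e = ContinuousLinearMap.adjoint T e := fun e =>
    ext_inner_diagVec fun f => by
      rw [ContinuousLinearMap.adjoint_inner_right, ContinuousLinearMap.adjoint_inner_right, h]
  have h2 : ContinuousLinearMap.adjoint S = ContinuousLinearMap.adjoint T :=
    ContinuousLinearMap.ext key
  exact ContinuousLinearMap.adjoint.injective h2

theorem createN_apply (h : H) (n : ℕ) (a : NParticle H n) :
    createN h n a =
      ((Real.sqrt (n + 1) : ℝ) : ℂ) • symmProj H (n + 1) (tensorLeft h n (incl H n a)) := rfl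

theorem createN_smul (c : ℂ) (f : H) (n : ℕ) : createN (c • f) n = c • createN f n := by
  ext a
  simp only [createN_apply, tensorLeft_smul, _root_.smul_apply, map_smul]
  exact smul_comm _ _ _

theorem norm_createN_apply_le (h : H) (n : ℕ) (a : NParticle H n) :
    ‖createN h n a‖ ≤ Real.sqrt (n + 1) * ‖h‖ * ‖a‖ := by
  rw [createN_apply, norm_smul, Complex.norm_real, Real.norm_of_nonneg (Real.sqrt_nonneg _),
    mul_assoc]
  refine mul_le_mul_of_nonneg_left ((norm_symmProj_le _ _).trans ?_) (Real.sqrt_nonneg _)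
  rw [norm_tensorLeft, norm_incl]

theorem inner_createN_left (h : H) (n : ℕ) (a : NParticle H n) (b : NParticle H (n + 1)) :
    ⟪createN h n a, b⟫_ℂ = ⟪a, annihilateN h n b⟫_ℂ :=
  (ContinuousLinearMap.adjoint_inner_right (createN h n) a b).symm

theorem inner_createN_right (h : H) (n : ℕ) (a : NParticle H n) (b : NParticle H (n + 1)) :
    ⟪b, createN h n a⟫_ℂ = ⟪annihilateN h n b, a⟫_ℂ :=
  (ContinuousLinearMap.adjoint_inner_left (createN h n) a b).symm

/-- The symmetrizing projection can be moved onto the diagonal vector, which it fixes. -/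
theorem inner_diagVec_createN (f h : H) (n : ℕ) (a : NParticle H n) :
    ⟪diagVec f (n + 1), createN h n a⟫_ℂ =
      ((Real.sqrt (n + 1) : ℝ) : ℂ) * (⟪f, h⟫_ℂ * ⟪diagVec f n, a⟫_ℂ) := by
  rw [createN_apply, inner_smul_right, inner_symmProj, incl_diagVec]
  congr 1
  exact inner_tensorLeft f h n (diagPow f n) (incl H n a)

theorem annihilateN_diagVec (h f : H) (n : ℕ) :
    annihilateN h n (diagVec f (n + 1)) =
      (((Real.sqrt (n + 1) : ℝ) : ℂ) * ⟪h, f⟫_ℂ) • diagVec f n := by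
  refine ext_inner_left ℂ fun a => ?_
  rw [← inner_createN_left, ← inner_conj_symm, inner_diagVec_createN, inner_smul_right]
  simp only [map_mul, inner_conj_symm, Complex.conj_ofReal]
  ring

/-- Annihilation sends a diagonal vector to a scalar multiple of a diagonal vector, and the scalars
commute. -/
theorem annihilateN_comm (g h : H) (n : ℕ) (a : NParticle H (n + 2)) :
    annihilateN g n (annihilateN h (n + 1) a) = annihilateN h n (annihilateN g (n + 1) a) := by
  have : (annihilateN g n).comp (annihilateN h (n + 1)) =
      (annihilateN h n).comp (annihilateN g (n + 1)) := by
    refine ext_diagVec fun f => ?_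
    simp only [ContinuousLinearMap.comp_apply, annihilateN_diagVec, map_smul, smul_smul]
    congr 1
    ring
  exact DFunLike.congr_fun this a

theorem createN_comm (g h : H) (n : ℕ) (a : NParticle H n) :
    createN g (n + 1) (createN h n a) = createN h (n + 1) (createN g n a) := by
  refine ext_inner_left ℂ fun b => ?_
  rw [inner_createN_right, inner_createN_right, inner_createN_right, inner_createN_right,
    annihilateN_comm]

/-- The derivative of `t ↦ (f + t h)^{⊗ (n+1)}` at `0` is `√(n+1) a^*(h) f^{⊗ n}`. -/
theorem hasDerivAt_diagVec (f h : H) (n : ℕ) :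
    HasDerivAt (fun t : ℂ => diagVec (f + t • h) (n + 1))
      (((Real.sqrt (n + 1) : ℝ) : ℂ) • createN h n (diagVec f n)) 0 := by
  have hd : ∀ m : ℕ, Differentiable ℂ fun t : ℂ => diagPow (f + t • h) m := by
    intro m
    induction m with
    | zero => exact differentiable_const (1 : ℂ)
    | succ m ih =>
      have : (fun t : ℂ => diagPow (f + t • h) (m + 1)) = fun t : ℂ =>
          tensorLeft f m (diagPow (f + t • h) m) + t • tensorLeft h m (diagPow (f + t • h) m) := by
        funext t
        change tensorLeft (f + t • h) m (diagPow (f + t • h) m) = _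
        rw [tensorLeft_add, tensorLeft_smul]
        rfl
      rw [this]
      exact ((tensorLeft f m).differentiable.comp ih).add
        (differentiable_id.smul ((tensorLeft h m).differentiable.comp ih))
  have hv : DifferentiableAt ℂ (fun t : ℂ => diagVec (f + t • h) (n + 1)) 0 := by
    have h1 : (fun t : ℂ => diagVec (f + t • h) (n + 1)) = fun t : ℂ =>
        symmProj H (n + 1) (diagPow (f + t • h) (n + 1)) := by
      funext t
      rw [← incl_diagVec, symmProj_incl]
    rw [h1]
    exact ((symmProj H (n + 1)).differentiable.comp (hd (n + 1))) 0
  have hd' := hv.hasDerivAt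
  convert hd' using 1
  -- The derivative exists; it is identified weakly. Paired with the diagonal vector of `k`, the
  -- curve is the scalar polynomial `(⟪k,f⟫ + t⟪k,h⟫)^(n+1)`.
  refine ext_inner_diagVec fun k => ?_
  have h2 : HasDerivAt (fun t : ℂ => ⟪diagVec k (n + 1), diagVec (f + t • h) (n + 1)⟫_ℂ)
      ⟪diagVec k (n + 1), deriv (fun t : ℂ => diagVec (f + t • h) (n + 1)) 0⟫_ℂ 0 :=
    ((innerSL ℂ (diagVec k (n + 1))).hasFDerivAt.comp_hasDerivAt (0 : ℂ) hd')
  have h3 : HasDerivAt (fun t : ℂ => (⟪k, f⟫_ℂ + t * ⟪k, h⟫_ℂ) ^ (n + 1))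
      (((n + 1 : ℕ) : ℂ) * (⟪k, f⟫_ℂ + 0 * ⟪k, h⟫_ℂ) ^ n * (1 * ⟪k, h⟫_ℂ)) 0 := by
    exact (((hasDerivAt_id (0 : ℂ)).mul_const ⟪k, h⟫_ℂ).const_add ⟪k, f⟫_ℂ).fun_pow (n + 1)
  simp only [inner_diagVec, inner_add_right, inner_smul_right] at h2
  rw [h2.unique h3, inner_smul_right, inner_diagVec_createN, inner_diagVec, ← mul_assoc,
    ← Complex.ofReal_mul, Real.mul_self_sqrt (by positivity)]
  push_cast
  ring

theorem annihilateN_createN_zero (g h : H) (a : NParticle H 0) :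
    annihilateN g 0 (createN h 0 a) = ⟪g, h⟫_ℂ • a := by
  have h0 : (annihilateN g 0).comp (createN h 0) = ⟪g, h⟫_ℂ • ContinuousLinearMap.id ℂ _ := by
    refine ext_diagVec fun f => ?_
    have hdv := (annihilateN g 0).hasFDerivAt.comp_hasDerivAt (0 : ℂ) (hasDerivAt_diagVec f h 0)
    have hdv' : HasDerivAt (fun t : ℂ => (⟪g, f⟫_ℂ + t * ⟪g, h⟫_ℂ) • diagVec f 0)
        ((1 * ⟪g, h⟫_ℂ) • diagVec f 0) (0 : ℂ) :=
      (((hasDerivAt_id (0 : ℂ)).mul_const ⟪g, h⟫_ℂ).const_add ⟪g, f⟫_ℂ).smul_const _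
    have he : (annihilateN g 0 ∘ fun t : ℂ => diagVec (f + t • h) (0 + 1)) =
        fun t : ℂ => (⟪g, f⟫_ℂ + t * ⟪g, h⟫_ℂ) • diagVec f 0 := by
      funext t
      simp only [Function.comp_apply, annihilateN_diagVec, inner_add_right, inner_smul_right]
      simp
      rfl
    rw [he] at hdv
    have := hdv.unique hdv'
    simpa using this
  exact DFunLike.congr_fun h0 a

/-- Annihilating `(f + t h)^{⊗(n+2)}` gives `√(n+2) (⟪g,f⟫ + t⟪g,h⟫)` times `(f + t h)^{⊗(n+1)}`.
Differentiating at `t = 0` turns the left side into `a(g) a^*(h)`, while the product rule on the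
right yields `a^*(h) a(g)` and the commutator term, all with the common factor `√(n+2)`. -/
theorem annihilateN_createN_succ (g h : H) (n : ℕ) (a : NParticle H (n + 1)) :
    annihilateN g (n + 1) (createN h (n + 1) a) =
      createN h n (annihilateN g n a) + ⟪g, h⟫_ℂ • a := by
  have h0 : (annihilateN g (n + 1)).comp (createN h (n + 1)) =
      (createN h n).comp (annihilateN g n) + ⟪g, h⟫_ℂ • ContinuousLinearMap.id ℂ _ := by
    refine ext_diagVec fun f => ?_
    have hdv := (annihilateN g (n + 1)).hasFDerivAt.comp_hasDerivAt (0 : ℂ)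
      (hasDerivAt_diagVec f h (n + 1))
    have hdv' := ((((hasDerivAt_id (0 : ℂ)).mul_const ⟪g, h⟫_ℂ).const_add ⟪g, f⟫_ℂ).const_mul
      (((Real.sqrt ((n + 1 : ℕ) + 1) : ℝ) : ℂ))).smul (hasDerivAt_diagVec f h n)
    have he : (annihilateN g (n + 1) ∘ fun t : ℂ => diagVec (f + t • h) (n + 1 + 1)) =
        fun t : ℂ => (((Real.sqrt ((n + 1 : ℕ) + 1) : ℝ) : ℂ) *
          (⟪g, f⟫_ℂ + t * ⟪g, h⟫_ℂ)) • diagVec (f + t • h) (n + 1) := by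
      funext t
      simp only [Function.comp_apply, annihilateN_diagVec, inner_add_right, inner_smul_right]
    rw [he] at hdv
    have h1 := hdv.unique hdv'
    have hs : (((Real.sqrt ((n + 1 : ℕ) + 1) : ℝ) : ℂ)) ≠ 0 := by
      rw [Complex.ofReal_ne_zero]
      positivity
    rw [map_smul] at h1
    refine smul_right_injective _ hs ?_
    simp only [ContinuousLinearMap.comp_apply, _root_.add_apply,
      _root_.smul_apply, ContinuousLinearMap.id_apply, annihilateN_diagVec, map_smul]
    refine h1.trans ?_
    simp only [id, zero_mul, add_zero, one_mul, zero_smul, smul_add, smul_smul]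
    congr 1
    congr 1
    ring
  exact DFunLike.congr_fun h0 a

end Fock


namespace Fock

variable {H : Type} [NormedAddCommGroup H] [InnerProductSpace ℂ H]

/-! ### Creation, annihilation and field operators on the finite particle vectors -/

theorem FiniteParticle.ext {ψ φ : FiniteParticle H}
    (h : ∀ n, (ψ : Space H) n = (φ : Space H) n) : ψ = φ :=
  Subtype.ext (lp.ext (funext h))

theorem create_apply_zero (h : H) (ψ : FiniteParticle H) : (create h ψ : Space H) 0 = 0 := rfl

theorem create_apply_succ (h : H) (ψ : FiniteParticle H) (n : ℕ) :
    (create h ψ : Space H) (n + 1) = createN h n ((ψ : Space H) n) := rfl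

theorem annihilate_apply (h : H) (ψ : FiniteParticle H) (n : ℕ) :
    (annihilate h ψ : Space H) n = annihilateN h n ((ψ : Space H) (n + 1)) := rfl

theorem coe_add_apply (ψ φ : FiniteParticle H) (n : ℕ) :
    ((ψ + φ : FiniteParticle H) : Space H) n = (ψ : Space H) n + (φ : Space H) n := rfl

theorem coe_smul_apply (c : ℂ) (ψ : FiniteParticle H) (n : ℕ) :
    ((c • ψ : FiniteParticle H) : Space H) n = c • (ψ : Space H) n := rfl

theorem create_smul (c : ℂ) (f : H) : create (c • f) = c • create f := by
  refine LinearMap.ext fun ψ => FiniteParticle.ext fun n => ?_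
  cases n with
  | zero => exact (smul_zero (A := NParticle H 0) c).symm
  | succ n =>
    rw [create_apply_succ, createN_smul]
    rfl

theorem annihilate_smul (c : ℂ) (f : H) :
    annihilate (c • f) = (starRingEnd ℂ) c • annihilate f := by
  refine LinearMap.ext fun ψ => FiniteParticle.ext fun n => ?_
  rw [annihilate_apply, annihilateN, createN_smul, map_smulₛₗ]
  rfl

theorem annihilate_create (g h : H) (ψ : FiniteParticle H) :
    annihilate g (create h ψ) = create h (annihilate g ψ) + ⟪g, h⟫_ℂ • ψ := by
  refine FiniteParticle.ext fun n => ?_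
  rw [annihilate_apply, create_apply_succ, coe_add_apply, coe_smul_apply]
  cases n with
  | zero => rw [annihilateN_createN_zero, create_apply_zero, zero_add]
  | succ n => rw [annihilateN_createN_succ, create_apply_succ, annihilate_apply]

theorem create_comm (g h : H) (ψ : FiniteParticle H) :
    create g (create h ψ) = create h (create g ψ) := by
  refine FiniteParticle.ext fun n => ?_
  match n with
  | 0 => rfl
  | 1 =>
    simp only [create_apply_succ, create_apply_zero, map_zero]
  | n + 2 =>
    simp only [create_apply_succ]
    exact createN_comm g h n _

theorem annihilate_comm (g h : H) (ψ : FiniteParticle H) :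
    annihilate g (annihilate h ψ) = annihilate h (annihilate g ψ) :=
  FiniteParticle.ext fun n => annihilateN_comm g h n _

theorem inner_create (h : H) (ψ φ : FiniteParticle H) :
    ⟪(create h ψ : Space H), (φ : Space H)⟫_ℂ = ⟪(ψ : Space H), (annihilate h φ : Space H)⟫_ℂ := by
  rw [lp.inner_eq_tsum, lp.inner_eq_tsum,
    (lp.summable_inner (𝕜 := ℂ) (create h ψ : Space H) (φ : Space H)).tsum_eq_zero_add]
  simp only [create_apply_zero, create_apply_succ, annihilate_apply, inner_zero_left, zero_add]
  exact tsum_congr fun n => inner_createN_left h n _ _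

theorem inner_annihilate (h : H) (ψ φ : FiniteParticle H) :
    ⟪(annihilate h ψ : Space H), (φ : Space H)⟫_ℂ = ⟪(ψ : Space H), (create h φ : Space H)⟫_ℂ := by
  rw [← inner_conj_symm, ← inner_create, inner_conj_symm]

/-! ### Particle number bounds and norm estimates -/

theorem hasSum_norm_sq (ψ : Space H) : HasSum (fun n => ‖ψ n‖ ^ 2) (‖ψ‖ ^ 2) := by
  have h := lp.hasSum_norm (p := 2) (by norm_num) ψ
  simpa using h

/-- `ψ` has no components with more than `N` particles. -/
def SuppLE (N : ℕ) (ψ : FiniteParticle H) : Prop := ∀ n, N < n → (ψ : Space H) n = 0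

theorem exists_suppLE (ψ : FiniteParticle H) : ∃ N, SuppLE N ψ := by
  obtain ⟨N, hN⟩ := ψ.2.bddAbove
  refine ⟨N, fun n hn => ?_⟩
  by_contra hc
  exact absurd (hN hc) (not_le.mpr hn)

theorem SuppLE.mono {N M : ℕ} {ψ : FiniteParticle H} (h : SuppLE N ψ) (hNM : N ≤ M) : SuppLE M ψ :=
  fun n hn => h n (hNM.trans_lt hn)

theorem SuppLE.add {N : ℕ} {ψ φ : FiniteParticle H} (h : SuppLE N ψ) (h' : SuppLE N φ) :
    SuppLE N (ψ + φ) := fun n hn => by rw [coe_add_apply, h n hn, h' n hn, add_zero]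

theorem SuppLE.smul {N : ℕ} {ψ : FiniteParticle H} (h : SuppLE N ψ) (c : ℂ) :
    SuppLE N (c • ψ) := fun n hn => by rw [coe_smul_apply, h n hn, smul_zero]

theorem SuppLE.create {N : ℕ} {ψ : FiniteParticle H} (hψ : SuppLE N ψ) (h : H) :
    SuppLE (N + 1) (create h ψ) := by
  intro n hn
  cases n with
  | zero => rfl
  | succ n => rw [create_apply_succ, hψ n (by omega), map_zero]

theorem SuppLE.annihilate {N : ℕ} {ψ : FiniteParticle H} (hψ : SuppLE N ψ) (h : H) :
    SuppLE N (annihilate h ψ) := by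
  intro n hn
  rw [annihilate_apply, hψ (n + 1) (by omega), map_zero]

theorem SuppLE.norm_create_le {N : ℕ} {ψ : FiniteParticle H} (hψ : SuppLE N ψ) (h : H) :
    ‖Fock.create h ψ‖ ≤ Real.sqrt (N + 1) * ‖h‖ * ‖ψ‖ := by
  refine le_of_sq_le_sq ?_ (by positivity)
  have h1 := (hasSum_nat_add_iff' 1).mpr (hasSum_norm_sq (Fock.create h ψ : Space H))
  simp only [Finset.range_one, Finset.sum_singleton, create_apply_zero, create_apply_succ,
    norm_zero, ne_eq, OfNat.ofNat_ne_zero, not_false_eq_true, zero_pow, sub_zero] at h1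
  have h2 := (hasSum_norm_sq (ψ : Space H)).mul_left ((Real.sqrt (N + 1) * ‖h‖) ^ 2)
  rw [mul_pow _ ‖ψ‖]
  refine hasSum_le (fun n => ?_) h1 h2
  rw [← mul_pow]
  refine pow_le_pow_left₀ (norm_nonneg _) ?_ 2
  by_cases hn : N < n
  · rw [hψ n hn]; simp
  · refine (norm_createN_apply_le h n _).trans ?_
    have : (n : ℝ) ≤ N := by exact_mod_cast not_lt.mp hn
    gcongr

/-- By adjointness `‖a ψ‖² = ⟪ψ, a^* a ψ⟫`, and the creation bound applies to `a ψ`, whose particle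
number is again at most `N`. -/
theorem SuppLE.norm_annihilate_le {N : ℕ} {ψ : FiniteParticle H} (hψ : SuppLE N ψ) (h : H) :
    ‖Fock.annihilate h ψ‖ ≤ Real.sqrt (N + 1) * ‖h‖ * ‖ψ‖ := by
  rcases eq_or_lt_of_le (norm_nonneg (Fock.annihilate h ψ)) with h0 | h0
  · rw [← h0]; positivity
  refine le_of_mul_le_mul_right ?_ h0
  have h1 : ‖Fock.annihilate h ψ‖ * ‖Fock.annihilate h ψ‖ =
      ‖⟪(ψ : Space H), (Fock.create h (Fock.annihilate h ψ) : Space H)⟫_ℂ‖ := by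
    rw [← inner_annihilate, inner_self_eq_norm_sq_to_K, norm_pow, RCLike.norm_ofReal, abs_norm, sq]
    rfl
  rw [h1]
  refine (norm_inner_le_norm _ _).trans ?_
  have h2 := (hψ.annihilate h).norm_create_le h
  calc ‖(ψ : Space H)‖ * ‖(Fock.create h (Fock.annihilate h ψ) : Space H)‖
      ≤ ‖ψ‖ * (Real.sqrt (N + 1) * ‖h‖ * ‖Fock.annihilate h ψ‖) :=
        mul_le_mul_of_nonneg_left h2 (norm_nonneg _)
    _ = _ := by ring

/-- The field operator `(a^*(h) + a(h)) / √2` on the finite particle vectors. -/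
def field (h : H) : Module.End ℂ (FiniteParticle H) :=
  (((Real.sqrt 2)⁻¹ : ℝ) : ℂ) • (create h + annihilate h)

theorem field_apply (h : H) (ψ : FiniteParticle H) :
    field h ψ = (((Real.sqrt 2)⁻¹ : ℝ) : ℂ) • (create h ψ + annihilate h ψ) := rfl

theorem field_neg (h : H) : field (-h) = -field h := by
  have h1 : create (-h) = -create h := by
    rw [← neg_one_smul ℂ, create_smul]
    exact LinearMap.ext fun ψ => neg_one_smul ℂ (create h ψ)
  have h2 : annihilate (-h) = -annihilate h := by
    rw [← neg_one_smul ℂ, annihilate_smul, map_neg, map_one]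
    exact LinearMap.ext fun ψ => neg_one_smul ℂ (annihilate h ψ)
  rw [field, field, h1, h2, ← neg_add, smul_neg]

theorem inner_field (h : H) (ψ φ : FiniteParticle H) :
    ⟪(field h ψ : Space H), (φ : Space H)⟫_ℂ = ⟪(ψ : Space H), (field h φ : Space H)⟫_ℂ := by
  simp only [field_apply, Submodule.coe_smul, Submodule.coe_add, inner_smul_left, inner_smul_right,
    inner_add_left, inner_add_right, inner_create, inner_annihilate, Complex.conj_ofReal]
  ring

/-- Only the mixed commutators survive; they contribute half of `⟪g,h⟫` minus its conjugate. -/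
theorem field_commutator (g h : H) (ψ : FiniteParticle H) :
    field g (field h ψ) = field h (field g ψ) + (Complex.I * ((⟪g, h⟫_ℂ).im : ℂ)) • ψ := by
  simp only [field_apply, map_smul, map_add, annihilate_create g h, annihilate_create h g,
    create_comm g h, annihilate_comm g h, smul_smul, smul_add, ← mul_assoc]
  have hs : (((Real.sqrt 2)⁻¹ : ℝ) : ℂ) * (((Real.sqrt 2)⁻¹ : ℝ) : ℂ) = 1 / 2 := by
    rw [← Complex.ofReal_mul, ← mul_inv, Real.mul_self_sqrt (by norm_num)]
    norm_num
  rw [hs]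
  have hi : (Complex.I * ((⟪g, h⟫_ℂ).im : ℂ)) = 1 / 2 * ⟪g, h⟫_ℂ - 1 / 2 * ⟪h, g⟫_ℂ := by
    rw [← inner_conj_symm h g]
    generalize ⟪g, h⟫_ℂ = z
    apply Complex.ext
    · simp
    · simp
      ring
  rw [hi, sub_smul]
  abel

theorem SuppLE.field {N : ℕ} {ψ : FiniteParticle H} (hψ : SuppLE N ψ) (h : H) :
    SuppLE (N + 1) (field h ψ) :=
  ((hψ.create h).add ((hψ.annihilate h).mono N.le_succ)).smul _

theorem SuppLE.norm_field_le {N : ℕ} {ψ : FiniteParticle H} (hψ : SuppLE N ψ) (h : H) :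
    ‖Fock.field h ψ‖ ≤ 2 * ‖h‖ * Real.sqrt (N + 1) * ‖ψ‖ := by
  rw [field_apply, norm_smul, Complex.norm_real, Real.norm_of_nonneg (by positivity)]
  have h1 : (Real.sqrt 2)⁻¹ ≤ 1 := inv_le_one_of_one_le₀ (by
    rw [Real.one_le_sqrt]; norm_num)
  calc (Real.sqrt 2)⁻¹ * ‖Fock.create h ψ + Fock.annihilate h ψ‖
      ≤ 1 * (‖Fock.create h ψ‖ + ‖Fock.annihilate h ψ‖) := by
        gcongr
        exact norm_add_le _ _
    _ ≤ 1 * (Real.sqrt (N + 1) * ‖h‖ * ‖ψ‖ + Real.sqrt (N + 1) * ‖h‖ * ‖ψ‖) := by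
        gcongr
        · exact hψ.norm_create_le h
        · exact hψ.norm_annihilate_le h
    _ = _ := by ring

theorem SuppLE.field_pow {N : ℕ} {ψ : FiniteParticle H} (hψ : SuppLE N ψ) (h : H) (k : ℕ) :
    SuppLE (N + k) ((Fock.field h ^ k) ψ) := by
  induction k with
  | zero => exact hψ
  | succ k ih =>
    rw [pow_succ', Module.End.mul_apply]
    exact ih.field h

/-- Each field raises the maximal particle number by one and costs the square root of the new
maximum; the product is `√((N+k)!/N!)`, written without division. -/
theorem SuppLE.norm_field_pow_le {N : ℕ} {ψ : FiniteParticle H} (hψ : SuppLE N ψ) {h : H} {M : ℝ}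
    (hM : 2 * ‖h‖ ≤ M) (k : ℕ) :
    Real.sqrt (N.factorial) * ‖(Fock.field h ^ k) ψ‖ ≤
      M ^ k * Real.sqrt ((N + k).factorial) * ‖ψ‖ := by
  have hM0 : 0 ≤ M := le_trans (by positivity) hM
  induction k with
  | zero => simp
  | succ k ih =>
    rw [pow_succ', Module.End.mul_apply]
    have h1 := (hψ.field_pow h k).norm_field_le h
    have h2 : Real.sqrt ((N + (k + 1)).factorial) =
        Real.sqrt ((N + k : ℕ) + 1) * Real.sqrt ((N + k).factorial) := by
      rw [← Real.sqrt_mul (by positivity), ← add_assoc, Nat.factorial_succ]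
      push_cast
      rfl
    calc Real.sqrt (N.factorial) * ‖Fock.field h ((Fock.field h ^ k) ψ)‖
        ≤ Real.sqrt (N.factorial) * (M * Real.sqrt ((N + k : ℕ) + 1) * ‖(Fock.field h ^ k) ψ‖) := by
          gcongr
          exact h1.trans (by gcongr)
      _ = M * Real.sqrt ((N + k : ℕ) + 1) * (Real.sqrt (N.factorial) * ‖(Fock.field h ^ k) ψ‖) := by
          ring
      _ ≤ M * Real.sqrt ((N + k : ℕ) + 1) * (M ^ k * Real.sqrt ((N + k).factorial) * ‖ψ‖) := by
          gcongr
      _ = _ := by rw [h2]; ring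

theorem factorial_add_le (a b : ℕ) :
    (a + b).factorial ≤ 2 ^ (a + b) * a.factorial * b.factorial := by
  rw [← Nat.add_choose_mul_factorial_mul_factorial a b]
  gcongr
  exact Nat.choose_le_two_pow _ _

/-- `factorial_add_le` splits `(N+k+j)!` at the price of powers of two, so that the bound factors in
`j` and `k` and the double exponential series is dominated by a product of two single ones. -/
theorem SuppLE.norm_field_pow_field_pow_le {N : ℕ} {ψ : FiniteParticle H} (hψ : SuppLE N ψ)
    {g h : H} {M : ℝ} (hg : 2 * ‖g‖ ≤ M) (hh : 2 * ‖h‖ ≤ M) (j k : ℕ) :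
    ‖(Fock.field h ^ j) ((Fock.field g ^ k) ψ)‖ ≤
      2 ^ N * ((2 * M) ^ j * Real.sqrt j.factorial) * ((2 * M) ^ k * Real.sqrt k.factorial) *
        ‖ψ‖ := by
  have hM0 : 0 ≤ M := le_trans (by positivity) hg
  have h1 := hψ.norm_field_pow_le hg k
  have h2 := (hψ.field_pow g k).norm_field_pow_le hh j
  have hN : 0 < Real.sqrt N.factorial := Real.sqrt_pos.mpr (by positivity)
  have hNk : 0 < Real.sqrt (N + k).factorial := Real.sqrt_pos.mpr (by positivity)
  have h3 : Real.sqrt ((N + k + j).factorial) ≤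
      2 ^ (N + k + j) * (Real.sqrt N.factorial * Real.sqrt k.factorial * Real.sqrt j.factorial) := by
    rw [← Real.sqrt_mul (by positivity), ← Real.sqrt_mul (by positivity)]
    refine Real.sqrt_le_iff.mpr ⟨by positivity, ?_⟩
    rw [mul_pow, Real.sq_sqrt (by positivity)]
    have h4 : (N + k + j).factorial ≤
        (2 ^ (N + k + j)) ^ 2 * (N.factorial * k.factorial * j.factorial) := by
      calc (N + k + j).factorial ≤ 2 ^ (N + k + j) * (N + k).factorial * j.factorial :=
            factorial_add_le _ _
        _ ≤ 2 ^ (N + k + j) * (2 ^ (N + k) * N.factorial * k.factorial) * j.factorial := by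
            gcongr
            exact factorial_add_le _ _
        _ ≤ 2 ^ (N + k + j) * (2 ^ (N + k + j) * N.factorial * k.factorial) * j.factorial := by
            have : 2 ^ (N + k) ≤ 2 ^ (N + k + j) := Nat.pow_le_pow_right two_pos (by omega)
            exact Nat.mul_le_mul_right _ (Nat.mul_le_mul_left _
              (Nat.mul_le_mul_right _ (Nat.mul_le_mul_right _ this)))
        _ = _ := by ring
    exact_mod_cast h4
  refine le_of_mul_le_mul_left ?_ (mul_pos hN hNk)
  calc Real.sqrt N.factorial * Real.sqrt (N + k).factorial *
        ‖(Fock.field h ^ j) ((Fock.field g ^ k) ψ)‖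
      = Real.sqrt N.factorial * (Real.sqrt (N + k).factorial *
        ‖(Fock.field h ^ j) ((Fock.field g ^ k) ψ)‖) := by ring
    _ ≤ Real.sqrt N.factorial * (M ^ j * Real.sqrt ((N + k + j).factorial) *
        ‖(Fock.field g ^ k) ψ‖) := by gcongr
    _ = M ^ j * Real.sqrt ((N + k + j).factorial) * (Real.sqrt N.factorial *
        ‖(Fock.field g ^ k) ψ‖) := by ring
    _ ≤ M ^ j * (2 ^ (N + k + j) * (Real.sqrt N.factorial * Real.sqrt k.factorial *
        Real.sqrt j.factorial)) * (M ^ k * Real.sqrt ((N + k).factorial) * ‖ψ‖) := by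
        gcongr
    _ = _ := by ring

theorem summable_pow_mul_sqrt_factorial_div (M : ℝ) :
    Summable fun k : ℕ => M ^ k * Real.sqrt k.factorial / k.factorial := by
  have h : ∀ k : ℕ, |M ^ k * Real.sqrt k.factorial / k.factorial| ≤
      ((2 * M ^ 2) ^ k / k.factorial + (1 / 2) ^ k) := by
    intro k
    have hk : (0 : ℝ) < k.factorial := by positivity
    have hs : 0 < Real.sqrt k.factorial := Real.sqrt_pos.mpr hk
    have hss : Real.sqrt k.factorial ^ 2 = k.factorial := Real.sq_sqrt hk.le
    have e1 : |M ^ k * Real.sqrt k.factorial / k.factorial| = |M| ^ k / Real.sqrt k.factorial := by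
      rw [abs_div, abs_mul, abs_pow, abs_of_pos hs, abs_of_pos hk]
      nth_rewrite 2 [← hss]
      field_simp
    have h2 : (Real.sqrt 2) ^ 2 = 2 := Real.sq_sqrt (by norm_num)
    -- The term is split as `a * b` with `b = (√2)⁻ᵏ`; then `a b ≤ a² + b²` compares it with an
    -- exponential and a geometric series.
    set a := (Real.sqrt 2) ^ k * |M| ^ k / Real.sqrt k.factorial with ha
    set b := ((Real.sqrt 2)⁻¹) ^ k with hb
    have e2 : |M| ^ k / Real.sqrt k.factorial = a * b := by
      rw [ha, hb, inv_pow]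
      field_simp
    have e3 : (2 * M ^ 2) ^ k / k.factorial = a ^ 2 := by
      rw [ha, div_pow, hss, mul_pow (Real.sqrt 2 ^ k), pow_right_comm, pow_right_comm |M|, h2,
        sq_abs, mul_pow]
    have e4 : (1 / 2 : ℝ) ^ k = b ^ 2 := by
      rw [hb, ← pow_mul, mul_comm k 2, pow_mul, inv_pow, h2]
      norm_num
    rw [e1, e2, e3, e4]
    nlinarith [sq_nonneg (a - b), sq_nonneg a, sq_nonneg b]
  exact Summable.of_norm_bounded
    ((Real.summable_pow_div_factorial _).add
      (summable_geometric_of_lt_one (by norm_num) (by norm_num))) h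

/-- The double exponential series of two fields converges absolutely on finite particle vectors. -/
theorem summable_norm_field_pow_field_pow (g h : H) (ψ : FiniteParticle H) :
    Summable fun p : ℕ × ℕ => ‖(field h ^ p.1) ((field g ^ p.2) ψ)‖ /
      (p.1.factorial * p.2.factorial) := by
  obtain ⟨N, hN⟩ := exists_suppLE ψ
  set M := max (2 * ‖g‖) (2 * ‖h‖)
  have hM0 : 0 ≤ M := le_trans (by positivity) (le_max_left _ _)
  have hs := summable_pow_mul_sqrt_factorial_div (2 * M)
  have hs2 := (hs.mul_of_nonneg hs (fun _ => by positivity) (fun _ => by positivity)).mul_left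
    (2 ^ N * ‖ψ‖)
  refine hs2.of_nonneg_of_le (fun _ => by positivity) fun p => ?_
  rw [div_le_iff₀ (by positivity)]
  refine (hN.norm_field_pow_field_pow_le (M := M) (le_max_left _ _) (le_max_right _ _) p.1 p.2).trans
    (le_of_eq ?_)
  field_simp

theorem summable_norm_field_pow (h : H) (ψ : FiniteParticle H) :
    Summable fun k : ℕ => ‖(field h ^ k) ψ‖ / k.factorial := by
  have := (summable_norm_field_pow_field_pow h h ψ).comp_injective
    (i := fun k : ℕ => ((k, 0) : ℕ × ℕ)) (fun a b hab => congrArg Prod.fst hab)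
  refine this.congr fun k => ?_
  simp

theorem dense_finiteParticle : Dense (FiniteParticle H : Set (Space H)) := by
  intro ψ
  have h := lp.hasSum_single (p := 2) (by norm_num) ψ
  refine mem_closure_of_tendsto h (Filter.Eventually.of_forall fun s => ?_)
  refine Submodule.sum_mem _ fun i _ => ?_
  refine (Set.finite_singleton i).subset fun n hn => ?_
  by_contra hc
  exact hn (lp.single_apply_ne 2 i _ hc)

end Fock


/-! ### Antidiagonal rearrangement of exponential series -/

/-- A summable double series may be summed along antidiagonals. -/
theorem HasSum.sum_antidiagonal {E : Type*} [NormedAddCommGroup E] {F : ℕ × ℕ → E} {a : E}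
    (h : HasSum F a) : HasSum (fun n => ∑ p ∈ Finset.HasAntidiagonal.antidiagonal n, F p) a := by
  have h1 := (Finset.HasAntidiagonal.sigmaAntidiagonalEquivProd (A := ℕ)).hasSum_iff.mpr h
  refine h1.sigma fun n => ?_
  have h2 := hasSum_fintype (fun p : Finset.HasAntidiagonal.antidiagonal n => F p)
  rwa [Finset.sum_coe_sort (Finset.HasAntidiagonal.antidiagonal n) F] at h2

theorem cast_factorial_add (j k : ℕ) : (((j + k).factorial : ℕ) : ℂ) =
    ((j + k).choose j : ℂ) * j.factorial * k.factorial := by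
  rw [← Nat.add_choose_mul_factorial_mul_factorial, Nat.choose_symm_add]
  push_cast
  rfl

theorem sum_antidiagonal_pow_div_factorial (x y : ℂ) (n : ℕ) :
    ∑ p ∈ Finset.HasAntidiagonal.antidiagonal n, x ^ p.1 / (p.1.factorial : ℂ) * (y ^ p.2 / (p.2.factorial : ℂ)) =
      (x + y) ^ n / n.factorial := by
  rw [(Commute.all x y).add_pow' n, Finset.sum_div]
  refine Finset.sum_congr rfl fun p hp => ?_
  rw [← Finset.HasAntidiagonal.mem_antidiagonal.mp hp, nsmul_eq_mul]
  have h0 : (((p.1 + p.2).choose p.1 : ℕ) : ℂ) ≠ 0 :=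
    Nat.cast_ne_zero.mpr (Nat.choose_pos (Nat.le_add_right _ _)).ne'
  have h1 : (p.1.factorial : ℂ) ≠ 0 := Nat.cast_ne_zero.mpr (Nat.factorial_ne_zero _)
  have h2 : (p.2.factorial : ℂ) ≠ 0 := Nat.cast_ne_zero.mpr (Nat.factorial_ne_zero _)
  rw [cast_factorial_add]
  field_simp

namespace Fock

variable {H : Type} [NormedAddCommGroup H] [InnerProductSpace ℂ H]

/-! ### Exponentials of field operators -/

/-- The terms of the exponential series of `i A` on a finite particle vector. -/
def expTerm (A : Module.End ℂ (FiniteParticle H)) (ψ : FiniteParticle H) (k : ℕ) : Space H :=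
  (Complex.I ^ k / (k.factorial : ℂ)) • (((A ^ k) ψ : FiniteParticle H) : Space H)

theorem norm_I_pow_div_factorial (k : ℕ) :
    ‖Complex.I ^ k / (k.factorial : ℂ)‖ = (k.factorial : ℝ)⁻¹ := by
  rw [norm_div, norm_pow, Complex.norm_I, one_pow, Complex.norm_natCast, one_div]

theorem norm_expTerm (A : Module.End ℂ (FiniteParticle H)) (ψ : FiniteParticle H) (k : ℕ) :
    ‖expTerm A ψ k‖ = ‖(A ^ k) ψ‖ / k.factorial := by
  rw [expTerm, norm_smul, norm_I_pow_div_factorial, div_eq_inv_mul]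
  rfl

variable {A : Module.End ℂ (FiniteParticle H)}

theorem IsExpI.unique {U V : Space H →L[ℂ] Space H} (hU : IsExpI A U) (hV : IsExpI A V) : U = V :=
  ContinuousLinearMap.ext fun ψ => congrFun
    (U.continuous.ext_on dense_finiteParticle V.continuous
      fun ψ hψ => (hU ⟨ψ, hψ⟩).unique (hV ⟨ψ, hψ⟩)) ψ

theorem IsExpI.expI_eq {U : Space H →L[ℂ] Space H} (hU : IsExpI A U) : expI A = U := by
  have h : ∃ U, IsExpI A U := ⟨U, hU⟩
  rw [expI, dif_pos h]
  exact h.choose_spec.unique hU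

theorem inner_pow_left (hsym : ∀ ψ φ : FiniteParticle H,
    ⟪(A ψ : Space H), (φ : Space H)⟫_ℂ = ⟪(ψ : Space H), (A φ : Space H)⟫_ℂ)
    (j : ℕ) (ψ φ : FiniteParticle H) :
    ⟪((A ^ j) ψ : Space H), (φ : Space H)⟫_ℂ = ⟪(ψ : Space H), ((A ^ j) φ : Space H)⟫_ℂ := by
  induction j generalizing ψ with
  | zero => rfl
  | succ j ih => rw [pow_succ, Module.End.mul_apply, ih, hsym, ← Module.End.mul_apply, ← pow_succ',
      ← pow_succ]

/-- Symmetry moves all powers of `A` to the right. The terms of total degree `n` then add up to `(-i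
+ i)ⁿ / n!` times one inner product, so only `n = 0` survives. -/
theorem inner_tsum_expTerm (hsym : ∀ ψ φ : FiniteParticle H,
    ⟪(A ψ : Space H), (φ : Space H)⟫_ℂ = ⟪(ψ : Space H), (A φ : Space H)⟫_ℂ)
    (hsum : ∀ ψ : FiniteParticle H, Summable fun k : ℕ => ‖(A ^ k) ψ‖ / k.factorial)
    (φ ψ : FiniteParticle H) :
    ⟪∑' j, expTerm A φ j, ∑' k, expTerm A ψ k⟫_ℂ = ⟪(φ : Space H), (ψ : Space H)⟫_ℂ := by
  have ha : Summable fun j => ‖expTerm A φ j‖ := by simpa only [norm_expTerm] using hsum φ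
  have hb : Summable fun j => ‖expTerm A ψ j‖ := by simpa only [norm_expTerm] using hsum ψ
  set F : ℕ × ℕ → ℂ := fun p => ⟪expTerm A φ p.1, expTerm A ψ p.2⟫_ℂ with hF
  have hFs : Summable F :=
    Summable.of_norm_bounded (ha.mul_of_nonneg hb (fun _ => norm_nonneg _) fun _ => norm_nonneg _)
      fun p => norm_inner_le_norm _ _
  have h1 : ∀ j, HasSum (fun k => F (j, k)) ⟪expTerm A φ j, ∑' k, expTerm A ψ k⟫_ℂ := fun j =>
    (innerSL ℂ (expTerm A φ j)).hasSum hb.of_norm.hasSum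
  have h2 : HasSum (fun j => ⟪expTerm A φ j, ∑' k, expTerm A ψ k⟫_ℂ)
      ⟪∑' j, expTerm A φ j, ∑' k, expTerm A ψ k⟫_ℂ := by
    have h3 := (innerSL ℂ (∑' k, expTerm A ψ k)).hasSum ha.of_norm.hasSum
    have h4 := h3.map (starRingEnd ℂ) Complex.continuous_conj
    simpa [Function.comp_def] using h4
  rw [h2.unique (hFs.hasSum.prod_fiberwise h1)]
  refine (hFs.hasSum.sum_antidiagonal).unique ?_
  have h5 : ∀ n, ∑ p ∈ Finset.HasAntidiagonal.antidiagonal n, F p =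
      (0 : ℂ) ^ n / n.factorial * ⟪(φ : Space H), ((A ^ n) ψ : Space H)⟫_ℂ := by
    intro n
    rw [show (0 : ℂ) = -Complex.I + Complex.I by ring, ← sum_antidiagonal_pow_div_factorial,
      Finset.sum_mul]
    refine Finset.sum_congr rfl fun p hp => ?_
    simp only [hF, expTerm, inner_smul_left, inner_smul_right]
    rw [inner_pow_left hsym, ← Module.End.mul_apply, ← pow_add, Finset.HasAntidiagonal.mem_antidiagonal.mp hp,
      map_div₀, map_pow, Complex.conj_I, Complex.conj_natCast]
    ring
  have h6 := hasSum_single (f := fun n => ∑ p ∈ Finset.HasAntidiagonal.antidiagonal n, F p) 0 (fun n hn => by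
    rw [h5, zero_pow hn, zero_div, zero_mul])
  rw [h5] at h6
  simpa using h6

/-- By `inner_tsum_expTerm` the series is isometric on the dense finite particle vectors, so it
extends continuously to Fock space. -/
theorem exists_isExpI (hsym : ∀ ψ φ : FiniteParticle H,
    ⟪(A ψ : Space H), (φ : Space H)⟫_ℂ = ⟪(ψ : Space H), (A φ : Space H)⟫_ℂ)
    (hsum : ∀ ψ : FiniteParticle H, Summable fun k : ℕ => ‖(A ^ k) ψ‖ / k.factorial) :
    ∃ U : Space H →L[ℂ] Space H, IsExpI A U := by
  have hs : ∀ ψ, Summable (expTerm A ψ) := fun ψ =>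
    Summable.of_norm (by simpa only [norm_expTerm] using hsum ψ)
  let E : FiniteParticle H →ₗ[ℂ] Space H :=
    { toFun := fun ψ => ∑' k, expTerm A ψ k
      map_add' := fun ψ φ => by
        rw [← (hs ψ).tsum_add (hs φ)]
        refine tsum_congr fun k => ?_
        simp only [expTerm, map_add, Submodule.coe_add, smul_add]
      map_smul' := fun c ψ => by
        rw [RingHom.id_apply, ← (hs ψ).tsum_const_smul]
        refine tsum_congr fun k => ?_
        simp only [expTerm, map_smul, Submodule.coe_smul]
        exact smul_comm _ _ _ }
  have hE : ∀ ψ, ‖E ψ‖ ≤ 1 * ‖(FiniteParticle H).subtype ψ‖ := fun ψ => by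
    rw [one_mul, @norm_eq_sqrt_re_inner ℂ, @norm_eq_sqrt_re_inner ℂ _ _ _ _ (Submodule.subtype _ ψ)]
    have : ⟪E ψ, E ψ⟫_ℂ = ⟪(ψ : Space H), (ψ : Space H)⟫_ℂ := inner_tsum_expTerm hsym hsum ψ ψ
    rw [this]
    rfl
  have hd : DenseRange (FiniteParticle H).subtype := by
    have := dense_finiteParticle (H := H)
    rwa [DenseRange, Submodule.coe_subtype, Subtype.range_coe]
  refine ⟨E.extendOfNorm (FiniteParticle H).subtype, fun ψ => ?_⟩
  have h1 := LinearMap.extendOfNorm_eq hd ⟨1, hE⟩ ψ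
  rw [Submodule.subtype_apply] at h1
  rw [h1]
  exact (hs ψ).hasSum

theorem IsExpI.inner_map_map (hsym : ∀ ψ φ : FiniteParticle H,
    ⟪(A ψ : Space H), (φ : Space H)⟫_ℂ = ⟪(ψ : Space H), (A φ : Space H)⟫_ℂ)
    (hsum : ∀ ψ : FiniteParticle H, Summable fun k : ℕ => ‖(A ^ k) ψ‖ / k.factorial)
    {U : Space H →L[ℂ] Space H} (hU : IsExpI A U) : star U * U = 1 := by
  have hd := dense_finiteParticle (H := H)
  refine ContinuousLinearMap.ext fun ψ => ?_
  refine ext_inner_left ℂ fun φ => ?_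
  have h : ∀ p : Space H × Space H,
      ⟪p.1, (star U * U) p.2⟫_ℂ = ⟪p.1, (1 : Space H →L[ℂ] Space H) p.2⟫_ℂ := by
    refine congrFun (Continuous.ext_on (hd.prod hd) (by fun_prop) (by fun_prop) ?_)
    rintro ⟨φ, ψ⟩ ⟨hφ, hψ⟩
    change ⟪φ, ContinuousLinearMap.adjoint U (U ψ)⟫_ℂ = ⟪φ, ψ⟫_ℂ
    rw [ContinuousLinearMap.adjoint_inner_right]
    have h1 : U φ = _ := (hU ⟨φ, hφ⟩).tsum_eq.symm
    have h2 : U ψ = _ := (hU ⟨ψ, hψ⟩).tsum_eq.symm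
    rw [h1, h2]
    exact inner_tsum_expTerm hsym hsum ⟨φ, hφ⟩ ⟨ψ, hψ⟩
  exact h (φ, ψ)

theorem IsExpI.star_eq (hsym : ∀ ψ φ : FiniteParticle H,
    ⟪(A ψ : Space H), (φ : Space H)⟫_ℂ = ⟪(ψ : Space H), (A φ : Space H)⟫_ℂ)
    {U V : Space H →L[ℂ] Space H} (hU : IsExpI A U) (hV : IsExpI (-A) V) : star U = V := by
  have hd := dense_finiteParticle (H := H)
  refine ContinuousLinearMap.ext fun ψ => ?_
  refine ext_inner_left ℂ fun φ => ?_
  have h : ∀ p : Space H × Space H, ⟪p.1, star U p.2⟫_ℂ = ⟪p.1, V p.2⟫_ℂ := by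
    refine congrFun (Continuous.ext_on (hd.prod hd) (by fun_prop) (by fun_prop) ?_)
    rintro ⟨φ, ψ⟩ ⟨hφ, hψ⟩
    change ⟪φ, ContinuousLinearMap.adjoint U ψ⟫_ℂ = ⟪φ, V ψ⟫_ℂ
    rw [ContinuousLinearMap.adjoint_inner_right]
    have h1 := ((innerSL ℂ ψ).hasSum (hU ⟨φ, hφ⟩)).map (starRingEnd ℂ) Complex.continuous_conj
    have h2 := (innerSL ℂ φ).hasSum (hV ⟨ψ, hψ⟩)
    simp only [Function.comp_def, innerSL_apply_apply, inner_conj_symm] at h1 h2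
    refine h1.unique ?_
    refine h2.congr_fun fun k => ?_
    rw [inner_smul_left, inner_smul_right, inner_pow_left hsym k ⟨φ, hφ⟩ ⟨ψ, hψ⟩, map_div₀, map_pow,
      Complex.conj_I, Complex.conj_natCast]
    rcases Nat.even_or_odd k with hk | hk
    · have h3 : (-A) ^ k = A ^ k := hk.neg_pow A
      rw [hk.neg_pow, h3]
    · have h3 : (-A) ^ k = -A ^ k := hk.neg_pow A
      rw [hk.neg_pow, h3, LinearMap.neg_apply, Submodule.coe_neg, inner_neg_right]
      ring
  exact h (φ, ψ)

/-- A scalar commutes with `A`, so this is the Cauchy product of two absolutely convergent series.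
It is what makes `W_out` a phase times `W_in`. -/
theorem IsExpI.add_smul_one (hsum : ∀ ψ : FiniteParticle H,
    Summable fun k : ℕ => ‖(A ^ k) ψ‖ / k.factorial)
    {U : Space H →L[ℂ] Space H} (hU : IsExpI A U) (c : ℂ) :
    IsExpI (A + c • 1) (Complex.exp (Complex.I * c) • U) := by
  intro ψ
  have h1 : HasSum (fun j : ℕ => (Complex.I * c) ^ j / (j.factorial : ℂ))
      (Complex.exp (Complex.I * c)) := by
    rw [Complex.exp_eq_exp_ℂ]
    exact NormedSpace.expSeries_div_hasSum_exp _
  have h1n : Summable fun j : ℕ => ‖(Complex.I * c) ^ j / (j.factorial : ℂ)‖ :=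
    NormedSpace.norm_expSeries_div_summable _
  have hb : Summable fun k => ‖expTerm A ψ k‖ := by simpa only [norm_expTerm] using hsum ψ
  have hs : Summable fun p : ℕ × ℕ =>
      ((Complex.I * c) ^ p.1 / (p.1.factorial : ℂ)) • expTerm A ψ p.2 :=
    Summable.of_norm_bounded (h1n.mul_of_nonneg hb (fun _ => norm_nonneg _) fun _ => norm_nonneg _)
      fun p => (norm_smul _ _).le
  have h2 := (h1.smul (hU ψ) hs).sum_antidiagonal
  refine h2.congr_fun fun n => ?_
  have h3 : (A + c • 1) ^ n = ∑ p ∈ Finset.HasAntidiagonal.antidiagonal n, n.choose p.1 • (c ^ p.1 • A ^ p.2) := by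
    rw [add_comm, Commute.add_pow']
    · simp only [smul_pow, one_pow, smul_mul_assoc, one_mul]
    · exact (Commute.one_left A).smul_left c
  rw [h3]
  simp only [LinearMap.sum_apply, Submodule.coe_sum, Finset.smul_sum]
  refine Finset.sum_congr rfl fun p hp => ?_
  rw [← Nat.cast_smul_eq_nsmul ℂ, LinearMap.smul_apply, LinearMap.smul_apply, Submodule.coe_smul,
    Submodule.coe_smul, smul_smul, smul_smul, smul_smul]
  congr 1
  rw [← Finset.HasAntidiagonal.mem_antidiagonal.mp hp]
  have h0 : (((p.1 + p.2).choose p.1 : ℕ) : ℂ) ≠ 0 :=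
    Nat.cast_ne_zero.mpr (Nat.choose_pos (Nat.le_add_right _ _)).ne'
  have h4 : (p.1.factorial : ℂ) ≠ 0 := Nat.cast_ne_zero.mpr (Nat.factorial_ne_zero _)
  have h5 : (p.2.factorial : ℂ) ≠ 0 := Nat.cast_ne_zero.mpr (Nat.factorial_ne_zero _)
  rw [cast_factorial_add, mul_pow, pow_add]
  field_simp

/-! ### Weyl operators and their commutation relations -/

/-- The Weyl operator `e^{i A(h)}` of the field `A(h)`. -/
def weyl (h : H) : Space H →L[ℂ] Space H := expI (field h)

/-- For fields the default value `0` in `expI` is never taken. -/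
theorem isExpI_weyl (h : H) : IsExpI (field h) (weyl h) := by
  obtain ⟨U, hU⟩ := exists_isExpI (inner_field h) (summable_norm_field_pow h)
  rw [weyl, hU.expI_eq]
  exact hU

theorem star_weyl_mul_weyl (h : H) : star (weyl h) * weyl h = 1 :=
  (isExpI_weyl h).inner_map_map (inner_field h) (summable_norm_field_pow h)

theorem star_weyl (h : H) : star (weyl h) = weyl (-h) := by
  refine (isExpI_weyl h).star_eq (inner_field h) ?_
  rw [← field_neg]
  exact isExpI_weyl (-h)

/-- The adjoint is the Weyl operator of `-h`, which is itself an isometry. -/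
theorem weyl_mul_star_weyl (h : H) : weyl h * star (weyl h) = 1 := by
  have h1 := star_weyl_mul_weyl (-h)
  rwa [star_weyl, neg_neg, ← star_weyl] at h1

theorem norm_weyl_apply (h : H) (Ψ : Space H) : ‖weyl h Ψ‖ = ‖Ψ‖ := by
  have h1 : ⟪weyl h Ψ, weyl h Ψ⟫_ℂ = ⟪Ψ, Ψ⟫_ℂ := by
    rw [← ContinuousLinearMap.adjoint_inner_right]
    have := DFunLike.congr_fun (star_weyl_mul_weyl h) Ψ
    exact congrArg (fun v => ⟪Ψ, v⟫_ℂ) this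
  rw [@norm_eq_sqrt_re_inner ℂ, @norm_eq_sqrt_re_inner ℂ _ _ _ _ Ψ, h1]

/-- The commutator of two fields is a scalar, so commuting past `k + 1` factors produces it `k + 1`
times. -/
theorem field_field_pow (g h : H) (k : ℕ) (ψ : FiniteParticle H) :
    field h ((field g ^ (k + 1)) ψ) = (field g ^ (k + 1)) (field h ψ) +
      ((k + 1 : ℂ) * (Complex.I * ((⟪h, g⟫_ℂ).im : ℂ))) • (field g ^ k) ψ := by
  induction k with
  | zero => simp [field_commutator h g]
  | succ k ih =>
    rw [pow_succ', Module.End.mul_apply, field_commutator h g, ih, map_add, map_smul,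
      ← Module.End.mul_apply, ← pow_succ', ← Module.End.mul_apply (field g) (field g ^ k), ← pow_succ',
      add_assoc, ← add_smul]
    congr 2
    push_cast
    ring

/-- Formally `A(h)^j W(g) = W(g) (A(h) - Im⟪h,g⟫)^j`. Since `W(g) ψ` need not be a finite particle
vector, the powers of `A(h)` are kept inside the exponential series. -/
theorem hasSum_field_pow_expTerm (g h : H) (j : ℕ) (ψ : FiniteParticle H) :
    HasSum (fun k : ℕ => (Complex.I ^ k / (k.factorial : ℂ)) •
      (((field h ^ j) ((field g ^ k) ψ) : FiniteParticle H) : Space H))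
      (weyl g (((field h + (-((⟪h, g⟫_ℂ).im : ℂ)) • 1) ^ j) ψ : FiniteParticle H)) := by
  induction j generalizing ψ with
  | zero => exact isExpI_weyl g ψ
  | succ j ih =>
    have h1 := ih (field h ψ)
    have h2 := (ih ψ).const_smul (-((⟪h, g⟫_ℂ).im : ℂ))
    have h3 : HasSum (fun k : ℕ => (Complex.I ^ k / (k.factorial : ℂ)) •
        (((field h ^ (j + 1)) ((field g ^ k) ψ) : FiniteParticle H) : Space H) -
        (Complex.I ^ k / (k.factorial : ℂ)) •
        (((field h ^ j) ((field g ^ k) (field h ψ)) : FiniteParticle H) : Space H))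
        ((-((⟪h, g⟫_ℂ).im : ℂ)) •
          weyl g (((field h + (-((⟪h, g⟫_ℂ).im : ℂ)) • 1) ^ j) ψ : FiniteParticle H)) := by
      -- The commutator vanishes for `k = 0`. For `k + 1` it lowers the power of `A(g)` by one, and
      -- its factor `(k + 1) i` turns the coefficient `i^(k+1)/(k+1)!` into `-i^k/k!`.
      refine (hasSum_nat_add_iff' 1).mp ?_
      have h0 : (field h ^ (j + 1)) ψ = (field h ^ j) (field h ψ) := by
        rw [pow_succ, Module.End.mul_apply]
      simp only [Finset.range_one, Finset.sum_singleton, pow_zero, Module.End.one_apply, h0,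
        sub_self, sub_zero]
      refine h2.congr_fun fun k => ?_
      rw [← smul_sub, ← Submodule.coe_sub, pow_succ (field h) j, Module.End.mul_apply,
        field_field_pow, map_add, add_sub_cancel_left, map_smul, Submodule.coe_smul, smul_smul,
        smul_smul]
      congr 1
      rw [Nat.factorial_succ, pow_succ]
      have hk : (k.factorial : ℂ) ≠ 0 := Nat.cast_ne_zero.mpr (Nat.factorial_ne_zero _)
      have hk1 : (k + 1 : ℂ) ≠ 0 := Nat.cast_add_one_ne_zero k
      push_cast
      field_simp
      rw [Complex.I_sq]
      ring
    have h4 := h3.add h1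
    simp only [sub_add_cancel] at h4
    convert h4 using 1
    rw [pow_succ, Module.End.mul_apply, LinearMap.add_apply, LinearMap.smul_apply, map_add,
      map_smul, Submodule.coe_add, map_add, Submodule.coe_smul, map_smul, add_comm]
    rfl

/-- The Weyl relations, as a commutation relation. -/
theorem weyl_mul_weyl (g h : H) :
    weyl h * weyl g = Complex.exp (-(Complex.I * ((⟪h, g⟫_ℂ).im : ℂ))) • (weyl g * weyl h) := by
  refine ContinuousLinearMap.ext fun ψ => ?_
  refine congrFun (Continuous.ext_on dense_finiteParticle (f := ⇑(weyl h * weyl g))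
    (g := ⇑(Complex.exp (-(Complex.I * ((⟪h, g⟫_ℂ).im : ℂ))) • (weyl g * weyl h)))
    (ContinuousLinearMap.continuous _) (ContinuousLinearMap.continuous _) ?_) ψ
  intro ψ hψ
  lift ψ to FiniteParticle H using hψ
  -- This absolutely convergent double series is summed in both orders. Summing over `j` first gives
  -- `W(h) W(g) ψ`; summing over `k` first gives `W(g)` applied to the exponential of the shifted
  -- field `A(h) - Im⟪h,g⟫`.
  set F : ℕ × ℕ → Space H := fun p => (Complex.I ^ p.1 / (p.1.factorial : ℂ)) •
    (Complex.I ^ p.2 / (p.2.factorial : ℂ)) •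
      (((field h ^ p.1) ((field g ^ p.2) ψ) : FiniteParticle H) : Space H) with hF
  have hFs : Summable F := by
    refine Summable.of_norm ((summable_norm_field_pow_field_pow g h ψ).congr fun p => ?_)
    rw [hF, norm_smul, norm_smul, norm_I_pow_div_factorial, norm_I_pow_div_factorial]
    simp only [Submodule.coe_norm]
    field_simp
  have h1 : HasSum (fun k : ℕ => (Complex.I ^ k / (k.factorial : ℂ)) •
      weyl h ((field g ^ k) ψ : FiniteParticle H)) (weyl h (weyl g ψ)) := by
    have := (weyl h).hasSum (isExpI_weyl g ψ)
    simpa only [map_smul] using this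
  have h2 : HasSum (fun k : ℕ => (Complex.I ^ k / (k.factorial : ℂ)) •
      weyl h ((field g ^ k) ψ : FiniteParticle H)) (∑' p, F p) := by
    have h3 : HasSum (F ∘ Prod.swap) (∑' p, F p) :=
      (Equiv.prodComm ℕ ℕ).hasSum_iff.mpr hFs.hasSum
    refine h3.prod_fiberwise fun k => ?_
    have := (isExpI_weyl h ((field g ^ k) ψ)).const_smul (Complex.I ^ k / (k.factorial : ℂ))
    refine this.congr_fun fun j => ?_
    exact smul_comm _ _ _
  have h4 := (isExpI_weyl h).add_smul_one (summable_norm_field_pow h) (-((⟪h, g⟫_ℂ).im : ℂ)) ψ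
  have h5 : HasSum (fun j : ℕ => (Complex.I ^ j / (j.factorial : ℂ)) •
      weyl g (((field h + (-((⟪h, g⟫_ℂ).im : ℂ)) • 1) ^ j) ψ : FiniteParticle H))
      (weyl g ((Complex.exp (Complex.I * (-((⟪h, g⟫_ℂ).im : ℂ))) • weyl h) ψ)) := by
    have := (weyl g).hasSum h4
    simpa only [map_smul] using this
  have h6 : HasSum (fun j : ℕ => (Complex.I ^ j / (j.factorial : ℂ)) •
      weyl g (((field h + (-((⟪h, g⟫_ℂ).im : ℂ)) • 1) ^ j) ψ : FiniteParticle H)) (∑' p, F p) :=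
    hFs.hasSum.prod_fiberwise fun j => (hasSum_field_pow_expTerm g h j ψ).const_smul _
  change weyl h (weyl g ψ) = Complex.exp (-(Complex.I * ((⟪h, g⟫_ℂ).im : ℂ))) • weyl g (weyl h ψ)
  rw [h1.unique h2, ← h5.unique h6, _root_.smul_apply, map_smul, mul_neg]

/-! ### Strong continuity of the Weyl operators -/

theorem tendsto_weyl_finiteParticle (ψ : FiniteParticle H) :
    Filter.Tendsto (fun h : H => weyl h ψ) (nhds 0) (nhds ψ) := by
  obtain ⟨N, hN⟩ := exists_suppLE ψ
  -- The limit is written as the exponential series of the zero operator, so that dominated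
  -- convergence can be applied term by term.
  have h0 : (ψ : Space H) = ∑' k, expTerm 0 ψ k := by
    rw [tsum_eq_single 0 fun k hk => by rw [expTerm, zero_pow hk]; simp]
    simp [expTerm]
  have h1 : (fun h : H => weyl h ψ) = fun h => ∑' k, expTerm (field h) ψ k := by
    funext h
    exact (isExpI_weyl h ψ).tsum_eq.symm
  rw [h1, h0]
  -- The dominating series is the bound for two fields with `j = k`, `k = 0` and `M = 2‖h‖`, taken
  -- at `‖h‖ = 1`.
  have hs := (summable_pow_mul_sqrt_factorial_div (2 * 2)).mul_left (2 ^ N * ‖ψ‖)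
  have hbound : ∀ h : H, ‖h‖ ≤ 1 → ∀ k, ‖(field h ^ k) ψ‖ ≤
      2 ^ N * ((4 * ‖h‖) ^ k * Real.sqrt k.factorial) * ‖ψ‖ := by
    intro h _ k
    have := hN.norm_field_pow_field_pow_le (M := 2 * ‖h‖) le_rfl le_rfl (h := h) k 0
    simp only [pow_zero, Module.End.one_apply, Nat.factorial_zero, Nat.cast_one, Real.sqrt_one,
      mul_one] at this
    rwa [← mul_assoc 2 2, show (2 * 2 : ℝ) = 4 by norm_num] at this
  refine tendsto_tsum_of_dominated_convergence hs (fun k => ?_) ?_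
  · rcases Nat.eq_zero_or_pos k with rfl | hk
    · simp only [expTerm, pow_zero]
      exact tendsto_const_nhds
    · have e : expTerm (0 : Module.End ℂ (FiniteParticle H)) ψ k = 0 := by
        rw [expTerm, zero_pow hk.ne']; simp
      rw [e, tendsto_zero_iff_norm_tendsto_zero]
      have hc : Filter.Tendsto (fun h : H => 2 ^ N * ((4 * ‖h‖) ^ k * Real.sqrt k.factorial) * ‖ψ‖ /
          k.factorial) (nhds 0) (nhds 0) := by
        have : Continuous fun h : H => 2 ^ N * ((4 * ‖h‖) ^ k * Real.sqrt k.factorial) * ‖ψ‖ /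
          k.factorial := by fun_prop
        have h2 := this.tendsto 0
        simpa [zero_pow hk.ne'] using h2
      refine squeeze_zero' (Filter.Eventually.of_forall fun _ => norm_nonneg _) ?_ hc
      filter_upwards [Metric.closedBall_mem_nhds (0 : H) one_pos] with h hh
      rw [norm_expTerm]
      gcongr
      exact hbound h (by simpa using hh) k
  · filter_upwards [Metric.closedBall_mem_nhds (0 : H) one_pos] with h hh k
    have hh' : ‖h‖ ≤ 1 := by simpa using hh
    rw [norm_expTerm]
    calc ‖(field h ^ k) ψ‖ / k.factorial
        ≤ 2 ^ N * ((4 * ‖h‖) ^ k * Real.sqrt k.factorial) * ‖ψ‖ / k.factorial := by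
          gcongr
          exact hbound h hh' k
      _ ≤ 2 ^ N * ((4 * 1) ^ k * Real.sqrt k.factorial) * ‖ψ‖ / k.factorial := by gcongr
      _ = _ := by
          rw [show (2 * 2 : ℝ) = 4 by norm_num, mul_one]
          ring

/-- Strong continuity of the Weyl operators at `h = 0`. -/
theorem tendsto_weyl (Ψ : Space H) :
    Filter.Tendsto (fun h : H => weyl h Ψ) (nhds 0) (nhds Ψ) := by
  rw [Metric.tendsto_nhds]
  intro ε hε
  obtain ⟨ψ, hψ, hψε⟩ := Metric.dense_iff.mp (dense_finiteParticle (H := H)) Ψ (ε / 3) (by positivity)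
  have h1 := Metric.tendsto_nhds.mp (tendsto_weyl_finiteParticle ⟨_, hψε⟩) (ε / 3) (by positivity)
  filter_upwards [h1] with h hh
  have h2 : dist (weyl h Ψ) (weyl h ψ) < ε / 3 := by
    rw [dist_eq_norm, ← map_sub, norm_weyl_apply, ← dist_eq_norm, dist_comm]
    exact hψ
  have h3 : dist ψ Ψ < ε / 3 := hψ
  have h4 := dist_triangle4 (weyl h Ψ) (weyl h ψ) ψ Ψ
  have hh' : dist (weyl h ψ) ψ < ε / 3 := hh
  linarith

end Fock


namespace PointSource

/-! ### The measure `dp / 2ω` and the transverse projection -/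

theorem measurable_photonDensity :
    Measurable fun p : R3 => ENNReal.ofReal (2 * ‖p‖)⁻¹ := by fun_prop

theorem integrable_photonMeasure_iff {E : Type*} [NormedAddCommGroup E] [NormedSpace ℝ E]
    {f : R3 → E} :
    Integrable f photonMeasure ↔ Integrable (fun p => (2 * ‖p‖)⁻¹ • f p) volume := by
  rw [photonMeasure, integrable_withDensity_iff_integrable_smul' measurable_photonDensity
    (Filter.Eventually.of_forall fun _ => ENNReal.ofReal_lt_top)]
  refine integrable_congr (Filter.Eventually.of_forall fun p => ?_)
  simp only
  rw [ENNReal.toReal_ofReal (by positivity)]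

theorem photonMeasure_ac : photonMeasure ≪ (volume : Measure R3) := withDensity_absolutelyContinuous _ _

theorem ae_photonMeasure_ne_zero : ∀ᵐ p ∂photonMeasure, p ≠ 0 :=
  photonMeasure_ac.ae_le (compl_mem_ae_iff.mpr (measure_singleton (0 : R3)))

/-- The decay `(1 + |p|²)⁻²` is integrable with respect to `dp / 2ω`. -/
theorem integrable_one_add_sq_inv :
    Integrable (fun p : R3 => ((1 + ‖p‖ ^ 2) ^ 2)⁻¹) photonMeasure := by
  rw [integrable_photonMeasure_iff]
  -- In polar coordinates the radial integrand is `r² (2r)⁻¹ (1+r²)⁻²`, which is at most `(1+r²)⁻¹`.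
  have h := (integrable_fun_norm_addHaar (volume : Measure R3)
    (f := fun r : ℝ => (2 * r)⁻¹ • ((1 + r ^ 2) ^ 2)⁻¹)).mpr ?_
  · exact h
  have h1 : IntegrableOn (fun r : ℝ => (1 + r ^ 2)⁻¹) (Set.Ioi 0) :=
    integrable_inv_one_add_sq.integrableOn
  refine Integrable.mono' h1 ?_ ?_
  · refine Measurable.aestronglyMeasurable ?_
    fun_prop
  · refine (ae_restrict_iff' measurableSet_Ioi).mpr (Filter.Eventually.of_forall fun r hr => ?_)
    have hr0 : (0 : ℝ) < r := hr
    have hd : Module.finrank ℝ R3 - 1 = 2 := by simp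
    rw [hd, Real.norm_of_nonneg (by positivity)]
    simp only [smul_eq_mul]
    have h2 : r ^ 2 * ((2 * r)⁻¹ * ((1 + r ^ 2) ^ 2)⁻¹) = r / 2 / (1 + r ^ 2) * (1 + r ^ 2)⁻¹ := by
      field_simp
    rw [h2]
    refine mul_le_of_le_one_left (by positivity) ?_
    rw [div_le_one (by positivity)]
    nlinarith [sq_nonneg (r - 1)]

/-- The origin is a null set, so the bound is not needed there, where the inverse powers of `|p|`
take default values. -/
theorem memLp_two_of_norm_sq_le {f : R3 → C3} {C : ℝ} {s : Set R3} (hs : MeasurableSet s)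
    (hf : AEStronglyMeasurable f photonMeasure)
    (h : ∀ p ∈ s, p ≠ 0 → ‖f p‖ ^ 2 ≤ C * ((1 + ‖p‖ ^ 2) ^ 2)⁻¹) :
    MemLp f 2 (photonMeasure.restrict s) := by
  rw [memLp_two_iff_integrable_sq_norm hf.restrict]
  refine Integrable.mono' (integrable_one_add_sq_inv.const_mul C).integrableOn
    (hf.restrict.norm.pow 2) ((ae_restrict_iff' hs).mpr ?_)
  filter_upwards [ae_photonMeasure_ne_zero] with p hp0 hp
  rw [Real.norm_of_nonneg (by positivity)]
  exact h p hp hp0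

/-- `complexify` as a continuous real linear map. -/
def complexifyL : R3 →L[ℝ] C3 :=
  LinearMap.toContinuousLinearMap
    { toFun := complexify
      map_add' := fun u v => by ext k; simp [complexify]
      map_smul' := fun c v => by ext k; simp [complexify] }

theorem complexifyL_apply (v : R3) : complexifyL v = complexify v := rfl

theorem continuous_complexify : Continuous complexify := complexifyL.continuous

theorem inner_complexify (u v : R3) : ⟪complexify u, complexify v⟫_ℂ = (⟪u, v⟫_ℝ : ℂ) := by
  simp [complexify, PiLp.inner_apply]

theorem norm_complexify (v : R3) : ‖complexify v‖ = ‖v‖ := by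
  simp [complexify, EuclideanSpace.norm_eq]

theorem transverse_eq (p : R3) (z : C3) :
    transverse p z = z - ((((‖p‖ ^ 2)⁻¹ : ℝ) : ℂ) * ⟪complexify p, z⟫_ℂ) • complexify p := by
  ext j
  simp only [transverse, LinearMap.coe_mk, AddHom.coe_mk, complexify, PiLp.sub_apply,
    PiLp.smul_apply, smul_eq_mul, PiLp.inner_apply, RCLike.inner_apply, Complex.conj_ofReal]
  rw [Finset.mul_sum, Finset.sum_mul]
  have h : z j = ∑ k, (if j = k then z k else 0) := by simp
  rw [h, ← Finset.sum_sub_distrib]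
  refine Finset.sum_congr rfl fun k _ => ?_
  split_ifs with hjk
  · push_cast
    ring
  · push_cast
    ring

/-- The triangle inequality with Cauchy-Schwarz suffices; the optimal constant `1` is not needed. -/
theorem norm_transverse_le (p : R3) (z : C3) : ‖transverse p z‖ ≤ 2 * ‖z‖ := by
  rw [transverse_eq]
  refine (norm_sub_le _ _).trans ?_
  rw [norm_smul, norm_mul, Complex.norm_real, Real.norm_of_nonneg (by positivity), norm_complexify]
  have h1 := norm_inner_le_norm (𝕜 := ℂ) (complexify p) z
  rw [norm_complexify] at h1
  rcases eq_or_ne p 0 with rfl | hp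
  · simp
    linarith [norm_nonneg z]
  have hp0 : 0 < ‖p‖ := norm_pos_iff.mpr hp
  calc ‖z‖ + (‖p‖ ^ 2)⁻¹ * ‖⟪complexify p, z⟫_ℂ‖ * ‖p‖
      ≤ ‖z‖ + (‖p‖ ^ 2)⁻¹ * (‖p‖ * ‖z‖) * ‖p‖ := by gcongr
    _ = 2 * ‖z‖ := by field_simp; ring

theorem transverse_transverse (p : R3) (z : C3) :
    transverse p (transverse p z) = transverse p z := by
  rw [transverse_eq p (transverse p z)]
  rcases eq_or_ne p 0 with rfl | hp
  · simp
  have hp0 : (‖p‖ : ℂ) ≠ 0 := by exact_mod_cast (norm_pos_iff.mpr hp).ne'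
  have h : ⟪complexify p, transverse p z⟫_ℂ = 0 := by
    rw [transverse_eq, inner_sub_right, inner_smul_right, inner_complexify,
      real_inner_self_eq_norm_sq]
    push_cast
    field_simp
    ring
  rw [h]
  simp

theorem transverse_smul_left {c : ℝ} (hc : c ≠ 0) (p : R3) (z : C3) :
    transverse (c • p) z = transverse p z := by
  have h : complexify (c • p) = (c : ℂ) • complexify p := complexifyL.map_smul c p
  rw [transverse_eq, transverse_eq, h, inner_smul_left, norm_smul, smul_smul, Complex.conj_ofReal]
  congr 2
  rw [mul_pow, Real.norm_eq_abs, sq_abs]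
  push_cast
  have hc' : (c : ℂ) ≠ 0 := by exact_mod_cast hc
  field_simp

theorem measurable_transverse {f : R3 → C3} (hf : Measurable f) :
    Measurable fun p => transverse p (f p) := by
  simp only [transverse_eq]
  have := continuous_complexify.measurable
  fun_prop

/-! ### The current `J` -/

theorem stronglyMeasurable_J {x : ℝ → R3} (hx : Continuous x) : StronglyMeasurable (J x) := by
  suffices h : StronglyMeasurable fun p : R3 =>
      ∫ s : ℝ, Complex.exp (Complex.I * (phase x p s : ℂ)) • complexify (deriv x s) from
    h.const_smul (-Complex.I * (((2 * Real.pi) ^ (-(3 / 2) : ℝ) : ℝ) : ℂ))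
  refine StronglyMeasurable.integral_prod_right' (f := fun q : R3 × ℝ =>
    Complex.exp (Complex.I * (phase x q.1 q.2 : ℂ)) • complexify (deriv x q.2)) ?_
  have h1 : Continuous fun q : R3 × ℝ => Complex.exp (Complex.I * (phase x q.1 q.2 : ℂ)) := by
    unfold phase
    fun_prop
  have h2 : Measurable fun q : R3 × ℝ => complexify (deriv x q.2) :=
    continuous_complexify.measurable.comp ((measurable_deriv x).comp measurable_snd)
  exact (h1.measurable.smul h2).stronglyMeasurable

theorem measurable_JT {x : ℝ → R3} (hx : Continuous x) : Measurable (JT x) :=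
  measurable_transverse (stronglyMeasurable_J hx).measurable

/-- The phase has modulus one, so the integral of `|x'|` is a bound uniform in `p`. -/
theorem exists_norm_J_le (x : ℝ → R3) : ∃ C, ∀ p, ‖J x p‖ ≤ C := by
  refine ⟨‖(-Complex.I * (((2 * Real.pi) ^ (-(3 / 2) : ℝ) : ℝ) : ℂ))‖ * ∫ s, ‖deriv x s‖,
    fun p => ?_⟩
  rw [J, norm_smul]
  refine mul_le_mul_of_nonneg_left ((norm_integral_le_integral_norm _).trans (le_of_eq ?_))
    (norm_nonneg _)
  refine integral_congr_ae (Filter.Eventually.of_forall fun s => ?_)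
  simp only
  rw [norm_smul, mul_comm Complex.I, Complex.norm_exp_ofReal_mul_I, one_mul, norm_complexify]

theorem exists_norm_JT_le (x : ℝ → R3) : ∃ C, ∀ p, ‖JT x p‖ ≤ C := by
  obtain ⟨C, hC⟩ := exists_norm_J_le x
  exact ⟨2 * C, fun p => (norm_transverse_le _ _).trans (by gcongr; exact hC p)⟩

theorem memLp_JT_closedBall {x : ℝ → R3} (hx : Continuous x) (R : ℝ) :
    MemLp (JT x) 2 (photonMeasure.restrict (Metric.closedBall 0 R)) := by
  obtain ⟨C, hC⟩ := exists_norm_JT_le x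
  refine memLp_two_of_norm_sq_le (C := C ^ 2 * (1 + R ^ 2) ^ 2) Metric.isClosed_closedBall.measurableSet
    (measurable_JT hx).aestronglyMeasurable fun p hp _ => ?_
  have hp' : ‖p‖ ≤ R := by simpa using hp
  rw [le_mul_inv_iff₀ (by positivity)]
  gcongr
  exact hC p

end PointSource


namespace PointSource

/-! ### Large momentum asymptotics of `J` -/

/-- The denominator `ω - p·v` is at least `ω (1 - v₀)`. -/
theorem one_sub_mul_norm_le {p v : R3} {v₀ : ℝ} (hv : ‖v‖ ≤ v₀) :
    (1 - v₀) * ‖p‖ ≤ ‖p‖ - ⟪p, v⟫_ℝ := by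
  have h1 := real_inner_le_norm p v
  have h2 : ‖p‖ * ‖v‖ ≤ ‖p‖ * v₀ := by gcongr
  linarith

/-- The boundary values `v / (ω - p·v)` of the first integration by parts. -/
def boundaryVec (p v : R3) : R3 := (‖p‖ - ⟪p, v⟫_ℝ)⁻¹ • v

theorem hasDerivAt_exp_phase {x : ℝ → R3} {v : R3} {s : ℝ} (p : R3) (hx : HasDerivAt x v s) :
    HasDerivAt (fun t => Complex.exp (Complex.I * (phase x p t : ℂ)))
      (Complex.exp (Complex.I * (phase x p s : ℂ)) * (Complex.I * ((‖p‖ - ⟪p, v⟫_ℝ : ℝ) : ℂ))) s := by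
  have h1 : HasDerivAt (fun t => phase x p t) (‖p‖ - ⟪p, v⟫_ℝ) s := by
    have h2 := ((innerSL ℝ p).hasFDerivAt.comp_hasDerivAt s hx)
    have h3 := ((hasDerivAt_id s).const_mul ‖p‖).sub h2
    simpa [phase, Function.comp_def] using! h3
  exact (h1.ofReal_comp.const_mul Complex.I).cexp

/-- The boundary values of the second integration by parts. -/
def boundaryVec₂ (p v v₁ : R3) : R3 :=
  (‖p‖ - ⟪p, v⟫_ℝ)⁻¹ ^ 2 • v₁ + ((‖p‖ - ⟪p, v⟫_ℝ)⁻¹ ^ 3 * ⟪p, v₁⟫_ℝ) • v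

/-- The integrand that is left after two integrations by parts. -/
def remainderVec (p v v₁ v₂ : R3) : R3 :=
  (‖p‖ - ⟪p, v⟫_ℝ)⁻¹ ^ 2 • v₂ + (3 * (‖p‖ - ⟪p, v⟫_ℝ)⁻¹ ^ 3 * ⟪p, v₁⟫_ℝ) • v₁ +
    (3 * (‖p‖ - ⟪p, v⟫_ℝ)⁻¹ ^ 4 * ⟪p, v₁⟫_ℝ ^ 2 + (‖p‖ - ⟪p, v⟫_ℝ)⁻¹ ^ 3 * ⟪p, v₂⟫_ℝ) • v

theorem hasDerivAt_inv_sub_inner {v : ℝ → R3} {w : R3} {s : ℝ} {p : R3}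
    (hp : ‖p‖ - ⟪p, v s⟫_ℝ ≠ 0) (dv : HasDerivAt v w s) :
    HasDerivAt (fun t => (‖p‖ - ⟪p, v t⟫_ℝ)⁻¹) ((‖p‖ - ⟪p, v s⟫_ℝ)⁻¹ ^ 2 * ⟪p, w⟫_ℝ) s := by
  have h2 : HasDerivAt (fun t => ⟪p, v t⟫_ℝ) ⟪p, w⟫_ℝ s :=
    (innerSL ℝ p).hasFDerivAt.comp_hasDerivAt s dv
  have h3 := (h2.const_sub ‖p‖).fun_inv hp
  rw [neg_neg] at h3
  convert! h3 using 1
  field_simp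

theorem hasDerivAt_boundaryVec {v : ℝ → R3} {w : R3} {s : ℝ} {p : R3}
    (hp : ‖p‖ - ⟪p, v s⟫_ℝ ≠ 0) (dv : HasDerivAt v w s) :
    HasDerivAt (fun t => boundaryVec p (v t))
      ((‖p‖ - ⟪p, v s⟫_ℝ) • boundaryVec₂ p (v s) w) s := by
  have h := (hasDerivAt_inv_sub_inner hp dv).fun_smul dv
  convert! h using 1
  rw [boundaryVec₂, smul_add, smul_smul, smul_smul]
  congr 2
  · field_simp
  · field_simp

theorem hasDerivAt_boundaryVec₂ {v v₁ : ℝ → R3} {w : R3} {s : ℝ} {p : R3}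
    (hp : ‖p‖ - ⟪p, v s⟫_ℝ ≠ 0) (dv : HasDerivAt v (v₁ s) s) (dv₁ : HasDerivAt v₁ w s) :
    HasDerivAt (fun t => boundaryVec₂ p (v t) (v₁ t)) (remainderVec p (v s) (v₁ s) w) s := by
  have dr := hasDerivAt_inv_sub_inner hp dv
  have dm₁ : HasDerivAt (fun t => ⟪p, v₁ t⟫_ℝ) ⟪p, w⟫_ℝ s :=
    (innerSL ℝ p).hasFDerivAt.comp_hasDerivAt s dv₁
  have h := ((dr.fun_pow 2).fun_smul dv₁).fun_add (((dr.fun_pow 3).fun_mul dm₁).fun_smul dv)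
  convert! h using 1
  rw [remainderVec]
  generalize (‖p‖ - ⟪p, v s⟫_ℝ)⁻¹ = r
  push_cast
  module

/-- Both integrations by parts are packed into one primitive. With `φ = |p| - p·v`, the two terms `±
iφ e^{iψ}` times `boundaryVec₂` cancel, and `φ` times `boundaryVec` is `v`; the integrand and the
remainder are left. -/
theorem hasDerivAt_primitive {x v v₁ : ℝ → R3} {w : R3} {s : ℝ} {p : R3}
    (hp : ‖p‖ - ⟪p, v s⟫_ℝ ≠ 0) (dx : HasDerivAt x (v s) s) (dv : HasDerivAt v (v₁ s) s)
    (dv₁ : HasDerivAt v₁ w s) :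
    HasDerivAt (fun t => Complex.exp (Complex.I * (phase x p t : ℂ)) •
        (-Complex.I • complexifyL (boundaryVec p (v t)) + complexifyL (boundaryVec₂ p (v t) (v₁ t))))
      (Complex.exp (Complex.I * (phase x p s : ℂ)) • complexifyL (v s) +
        Complex.exp (Complex.I * (phase x p s : ℂ)) • complexifyL (remainderVec p (v s) (v₁ s) w))
      s := by
  have h1 : HasDerivAt (fun t => complexifyL (boundaryVec p (v t)))
      (complexifyL ((‖p‖ - ⟪p, v s⟫_ℝ) • boundaryVec₂ p (v s) (v₁ s))) s :=
    complexifyL.hasFDerivAt.comp_hasDerivAt s (hasDerivAt_boundaryVec hp dv)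
  have h2 : HasDerivAt (fun t => complexifyL (boundaryVec₂ p (v t) (v₁ t)))
      (complexifyL (remainderVec p (v s) (v₁ s) w)) s :=
    complexifyL.hasFDerivAt.comp_hasDerivAt s (hasDerivAt_boundaryVec₂ hp dv dv₁)
  have h3 := (hasDerivAt_exp_phase p dx).fun_smul ((h1.fun_const_smul (-Complex.I)).fun_add h2)
  convert! h3 using 1
  have hv : complexifyL (v s) = ((‖p‖ - ⟪p, v s⟫_ℝ : ℝ) : ℂ) • complexifyL (boundaryVec p (v s)) := by
    rw [Complex.coe_smul, ← map_smul, boundaryVec, smul_smul, mul_inv_cancel₀ hp, one_smul]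
  rw [map_smul, hv, ← Complex.coe_smul]
  generalize ((‖p‖ - ⟪p, v s⟫_ℝ : ℝ) : ℂ) = φ
  generalize complexifyL (boundaryVec p (v s)) = z
  generalize complexifyL (boundaryVec₂ p (v s) (v₁ s)) = z₁
  generalize complexifyL (remainderVec p (v s) (v₁ s) w) = z₂
  generalize Complex.exp (Complex.I * (phase x p s : ℂ)) = ε
  have h4 : ε • φ • z + ε • z₂ - (ε • (-Complex.I • φ • z₁ + z₂) +
      (ε * (Complex.I * φ)) • (-Complex.I • z + z₁)) =
      (ε * φ) • ((Complex.I * Complex.I) • z + z) := by module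
  rw [← sub_eq_zero, h4, Complex.I_mul_I, neg_one_smul, neg_add_cancel, smul_zero]

theorem inv_sub_inner_bounds {p v : R3} {v₀ : ℝ} (hv₀ : v₀ < 1) (hp : p ≠ 0) (hv : ‖v‖ ≤ v₀) :
    0 < ‖p‖ - ⟪p, v⟫_ℝ ∧ (‖p‖ - ⟪p, v⟫_ℝ)⁻¹ ≤ (1 - v₀)⁻¹ * ‖p‖⁻¹ := by
  have hp0 : 0 < ‖p‖ := norm_pos_iff.mpr hp
  have hc0 : 0 < 1 - v₀ := by linarith
  have h := one_sub_mul_norm_le (p := p) hv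
  refine ⟨(mul_pos hc0 hp0).trans_le h, ?_⟩
  rw [← mul_inv]
  exact inv_anti₀ (mul_pos hc0 hp0) h

theorem norm_boundaryVec₂_le {p v v₁ : R3} {v₀ K₁ : ℝ} (hv₀ : v₀ < 1) (hp : p ≠ 0) (hv : ‖v‖ ≤ v₀)
    (hv₁ : ‖v₁‖ ≤ K₁) :
    ‖boundaryVec₂ p v v₁‖ ≤
      ((1 - v₀)⁻¹ ^ 2 * K₁ + (1 - v₀)⁻¹ ^ 3 * K₁ * v₀) / ‖p‖ ^ 2 := by
  obtain ⟨h0, hr⟩ := inv_sub_inner_bounds hv₀ hp hv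
  have hp0 : 0 < ‖p‖ := norm_pos_iff.mpr hp
  have hc0 : 0 < 1 - v₀ := by linarith
  have h1 : |⟪p, v₁⟫_ℝ| ≤ ‖p‖ * K₁ := (abs_real_inner_le_norm _ _).trans (by gcongr)
  rw [boundaryVec₂]
  have hr0 := (inv_pos.mpr h0).le
  generalize (‖p‖ - ⟪p, v⟫_ℝ)⁻¹ = r at hr hr0 ⊢
  generalize (1 - v₀) = c at hr hc0 ⊢
  have hK : 0 ≤ K₁ := (norm_nonneg _).trans hv₁
  have hV : 0 ≤ v₀ := (norm_nonneg _).trans hv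
  calc ‖r ^ 2 • v₁ + (r ^ 3 * ⟪p, v₁⟫_ℝ) • v‖ ≤ r ^ 2 * ‖v₁‖ + r ^ 3 * |⟪p, v₁⟫_ℝ| * ‖v‖ := by
        refine (norm_add_le _ _).trans (le_of_eq ?_)
        rw [norm_smul, norm_smul, Real.norm_eq_abs, Real.norm_eq_abs, abs_mul, abs_pow, abs_pow,
          abs_of_nonneg hr0]
    _ ≤ (c⁻¹ * ‖p‖⁻¹) ^ 2 * K₁ + (c⁻¹ * ‖p‖⁻¹) ^ 3 * (‖p‖ * K₁) * v₀ := by gcongr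
    _ = _ := by field_simp

/-- Every term has exactly two more factors `(|p| - p·v)⁻¹`, each `O(|p|⁻¹)`, than inner products
with `p`, each `O(|p|)`. -/
theorem norm_remainderVec_le {p v v₁ v₂ : R3} {v₀ K₁ K₂ : ℝ} (hv₀ : v₀ < 1) (hp : p ≠ 0)
    (hv : ‖v‖ ≤ v₀) (hv₁ : ‖v₁‖ ≤ K₁) (hv₂ : ‖v₂‖ ≤ K₂) :
    ‖remainderVec p v v₁ v₂‖ ≤
      ((1 - v₀)⁻¹ ^ 2 * K₂ + 3 * (1 - v₀)⁻¹ ^ 3 * K₁ * K₁ +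
        (3 * (1 - v₀)⁻¹ ^ 4 * K₁ ^ 2 + (1 - v₀)⁻¹ ^ 3 * K₂) * v₀) / ‖p‖ ^ 2 := by
  obtain ⟨h0, hr⟩ := inv_sub_inner_bounds hv₀ hp hv
  have hp0 : 0 < ‖p‖ := norm_pos_iff.mpr hp
  have hc0 : 0 < 1 - v₀ := by linarith
  have h1 : |⟪p, v₁⟫_ℝ| ≤ ‖p‖ * K₁ := (abs_real_inner_le_norm _ _).trans (by gcongr)
  have h2 : |⟪p, v₂⟫_ℝ| ≤ ‖p‖ * K₂ := (abs_real_inner_le_norm _ _).trans (by gcongr)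
  rw [remainderVec]
  have hr0 := (inv_pos.mpr h0).le
  generalize (‖p‖ - ⟪p, v⟫_ℝ)⁻¹ = r at hr hr0 ⊢
  generalize (1 - v₀) = c at hr hc0 ⊢
  generalize ⟪p, v₁⟫_ℝ = m₁ at h1 ⊢
  generalize ⟪p, v₂⟫_ℝ = m₂ at h2 ⊢
  have hK : 0 ≤ K₁ := (norm_nonneg _).trans hv₁
  have hK₂ : 0 ≤ K₂ := (norm_nonneg _).trans hv₂
  have hV : 0 ≤ v₀ := (norm_nonneg _).trans hv
  calc _ ≤ r ^ 2 * ‖v₂‖ + 3 * r ^ 3 * |m₁| * ‖v₁‖ +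
        (3 * r ^ 4 * |m₁| ^ 2 + r ^ 3 * |m₂|) * ‖v‖ := by
        refine (norm_add₃_le).trans ?_
        rw [norm_smul, norm_smul, norm_smul, Real.norm_eq_abs, Real.norm_eq_abs, abs_mul, abs_mul,
          abs_pow, abs_pow, abs_of_nonneg hr0, abs_of_pos (by norm_num : (0 : ℝ) < 3)]
        gcongr
        refine (norm_add_le _ _).trans (le_of_eq ?_)
        rw [Real.norm_eq_abs, Real.norm_eq_abs, abs_mul, abs_mul, abs_mul,
          abs_pow, abs_pow, abs_pow, abs_of_nonneg hr0, abs_of_pos (by norm_num : (0 : ℝ) < 3)]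
    _ ≤ (c⁻¹ * ‖p‖⁻¹) ^ 2 * K₂ + 3 * (c⁻¹ * ‖p‖⁻¹) ^ 3 * (‖p‖ * K₁) * K₁ +
        (3 * (c⁻¹ * ‖p‖⁻¹) ^ 4 * (‖p‖ * K₁) ^ 2 + (c⁻¹ * ‖p‖⁻¹) ^ 3 * (‖p‖ * K₂)) * v₀ := by
        gcongr
    _ = _ := by field_simp

theorem norm_exp_phase (x : ℝ → R3) (p : R3) (s : ℝ) :
    ‖Complex.exp (Complex.I * (phase x p s : ℂ))‖ = 1 := by
  rw [mul_comm, Complex.norm_exp_ofReal_mul_I]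

/-- Two integrations by parts in `∫ x'(s) e^{i(ω s - p·x(s))} ds`: up to a term of order `|p|⁻²`
the integral is given by the boundary terms of the first. -/
theorem exists_norm_oscillatory_sub_le {x v v₁ v₂ : ℝ → R3} {a b v₀ : ℝ} (hab : a ≤ b) (hv₀ : v₀ < 1)
    (hx : ContinuousOn x (Set.Icc a b)) (hv : ContinuousOn v (Set.Icc a b))
    (hv₁ : ContinuousOn v₁ (Set.Icc a b)) (hv₂ : ContinuousOn v₂ (Set.Icc a b))
    (dx : ∀ s ∈ Set.Ioo a b, HasDerivAt x (v s) s)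
    (dv : ∀ s ∈ Set.Ioo a b, HasDerivAt v (v₁ s) s)
    (dv₁ : ∀ s ∈ Set.Ioo a b, HasDerivAt v₁ (v₂ s) s)
    (hle : ∀ s ∈ Set.Icc a b, ‖v s‖ ≤ v₀) :
    ∃ C, ∀ p : R3, p ≠ 0 →
      ‖(∫ s in a..b, Complex.exp (Complex.I * (phase x p s : ℂ)) • complexify (v s)) -
        (-Complex.I) • (Complex.exp (Complex.I * (phase x p b : ℂ)) •
            complexify (boundaryVec p (v b)) -
          Complex.exp (Complex.I * (phase x p a : ℂ)) • complexify (boundaryVec p (v a)))‖ ≤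
        C / ‖p‖ ^ 2 := by
  obtain ⟨K₁, hK₁⟩ := isCompact_Icc.exists_bound_of_continuousOn hv₁
  obtain ⟨K₂, hK₂⟩ := isCompact_Icc.exists_bound_of_continuousOn hv₂
  have ha := Set.left_mem_Icc.mpr hab
  have hb := Set.right_mem_Icc.mpr hab
  obtain ⟨B₁, hB₁⟩ : ∃ B₁, ∀ p : R3, p ≠ 0 → ∀ s ∈ Set.Icc a b,
      ‖boundaryVec₂ p (v s) (v₁ s)‖ ≤ B₁ / ‖p‖ ^ 2 :=
    ⟨_, fun p hp s hs => norm_boundaryVec₂_le hv₀ hp (hle s hs) (hK₁ s hs)⟩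
  obtain ⟨B₂, hB₂⟩ : ∃ B₂, ∀ p : R3, p ≠ 0 → ∀ s ∈ Set.Icc a b,
      ‖remainderVec p (v s) (v₁ s) (v₂ s)‖ ≤ B₂ / ‖p‖ ^ 2 :=
    ⟨_, fun p hp s hs => norm_remainderVec_le hv₀ hp (hle s hs) (hK₁ s hs) (hK₂ s hs)⟩
  refine ⟨B₁ + B₁ + B₂ * |b - a|, fun p hp => ?_⟩
  have hφ : ∀ s ∈ Set.Icc a b, ‖p‖ - ⟪p, v s⟫_ℝ ≠ 0 := fun s hs =>
    (inv_sub_inner_bounds hv₀ hp (hle s hs)).1.ne'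
  have hrc : ContinuousOn (fun s => (‖p‖ - ⟪p, v s⟫_ℝ)⁻¹) (Set.Icc a b) :=
    (continuousOn_const.sub (continuousOn_const.inner hv)).inv₀ hφ
  have hm₁c : ContinuousOn (fun s => ⟪p, v₁ s⟫_ℝ) (Set.Icc a b) := continuousOn_const.inner hv₁
  have hm₂c : ContinuousOn (fun s => ⟪p, v₂ s⟫_ℝ) (Set.Icc a b) := continuousOn_const.inner hv₂
  have hec : ContinuousOn (fun s => Complex.exp (Complex.I * (phase x p s : ℂ))) (Set.Icc a b) := by
    have : ContinuousOn (fun s => phase x p s) (Set.Icc a b) :=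
      (continuousOn_const.mul continuousOn_id).sub (continuousOn_const.inner hx)
    exact ((Complex.continuous_ofReal.comp_continuousOn this).const_smul Complex.I).cexp
  have hg₀c : ContinuousOn (fun s => boundaryVec p (v s)) (Set.Icc a b) := hrc.smul hv
  have hg₁c : ContinuousOn (fun s => boundaryVec₂ p (v s) (v₁ s)) (Set.Icc a b) :=
    ((hrc.pow 2).smul hv₁).add (((hrc.pow 3).mul hm₁c).smul hv)
  have hh₁c : ContinuousOn (fun s => remainderVec p (v s) (v₁ s) (v₂ s)) (Set.Icc a b) :=
    (((hrc.pow 2).smul hv₂).add (((continuousOn_const.mul (hrc.pow 3)).mul hm₁c).smul hv₁)).add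
      ((((continuousOn_const.mul (hrc.pow 4)).mul (hm₁c.pow 2)).add ((hrc.pow 3).mul hm₂c)).smul hv)
  have hI₁ : IntervalIntegrable (fun s => Complex.exp (Complex.I * (phase x p s : ℂ)) •
      complexifyL (v s)) volume a b :=
    (hec.smul (complexifyL.continuous.comp_continuousOn hv)).intervalIntegrable_of_Icc hab
  have hI₂ : IntervalIntegrable (fun s => Complex.exp (Complex.I * (phase x p s : ℂ)) •
      complexifyL (remainderVec p (v s) (v₁ s) (v₂ s))) volume a b :=
    (hec.smul (complexifyL.continuous.comp_continuousOn hh₁c)).intervalIntegrable_of_Icc hab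
  -- Only continuity up to the endpoints is required here, with derivatives in the open interval.
  -- This allows an endpoint at the jump of the velocity.
  have hftc := intervalIntegral.integral_eq_sub_of_hasDerivAt_of_le hab
    (hec.smul (((complexifyL.continuous.comp_continuousOn hg₀c).const_smul (-Complex.I)).add
      (complexifyL.continuous.comp_continuousOn hg₁c)))
    (fun s hs => hasDerivAt_primitive (hφ s (Set.Ioo_subset_Icc_self hs)) (dx s hs) (dv s hs)
      (dv₁ s hs)) (hI₁.add hI₂)
  rw [intervalIntegral.integral_add hI₁ hI₂] at hftc
  have hint : ‖∫ s in a..b, Complex.exp (Complex.I * (phase x p s : ℂ)) •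
      complexifyL (remainderVec p (v s) (v₁ s) (v₂ s))‖ ≤ B₂ / ‖p‖ ^ 2 * |b - a| := by
    refine intervalIntegral.norm_integral_le_of_norm_le_const fun s hs => ?_
    rw [Set.uIoc_of_le hab] at hs
    rw [norm_smul, norm_exp_phase, one_mul, complexifyL_apply, norm_complexify]
    exact hB₂ p hp s (Set.Ioc_subset_Icc_self hs)
  have hends : ∀ s ∈ Set.Icc a b, ‖Complex.exp (Complex.I * (phase x p s : ℂ)) •
      complexifyL (boundaryVec₂ p (v s) (v₁ s))‖ ≤ B₁ / ‖p‖ ^ 2 := fun s hs => by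
    rw [norm_smul, norm_exp_phase, one_mul, complexifyL_apply, norm_complexify]
    exact hB₁ p hp s hs
  have key := eq_sub_of_add_eq hftc
  have hea := hends a ha
  have heb := hends b hb
  simp only [complexifyL_apply, Function.comp_apply, Pi.smul_apply', Pi.add_apply, Pi.smul_apply]
    at key hea heb hint
  rw [key]
  generalize (∫ s in a..b, Complex.exp (Complex.I * (phase x p s : ℂ)) •
      complexify (remainderVec p (v s) (v₁ s) (v₂ s))) = R at hint ⊢
  generalize Complex.exp (Complex.I * (phase x p a : ℂ)) = εa at hea ⊢
  generalize Complex.exp (Complex.I * (phase x p b : ℂ)) = εb at heb ⊢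
  generalize complexify (boundaryVec₂ p (v a) (v₁ a)) = za at hea ⊢
  generalize complexify (boundaryVec₂ p (v b) (v₁ b)) = zb at heb ⊢
  generalize complexify (boundaryVec p (v a)) = ya
  generalize complexify (boundaryVec p (v b)) = yb
  have h7 : εb • (-Complex.I • yb + zb) - εa • (-Complex.I • ya + za) - R -
      -Complex.I • (εb • yb - εa • ya) = εb • zb - εa • za - R := by module
  calc _ = ‖εb • zb - εa • za - R‖ := congrArg _ h7
    _ ≤ ‖εb • zb‖ + ‖εa • za‖ + ‖R‖ :=
        (norm_sub_le _ _).trans (by gcongr; exact norm_sub_le _ _)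
    _ ≤ B₁ / ‖p‖ ^ 2 + B₁ / ‖p‖ ^ 2 + B₂ / ‖p‖ ^ 2 * |b - a| := by gcongr
    _ = _ := by ring

/-- The asymptotics of the oscillatory integral for a trajectory which is `C³` on a half line. -/
theorem exists_norm_oscillatory_sub_le_of_contDiffOn {x : ℝ → R3} {S : Set ℝ} {a b v₀ : ℝ}
    (hab : a ≤ b) (hv₀ : v₀ < 1) (hS : UniqueDiffOn ℝ S) (hx : ContDiffOn ℝ 3 x S)
    (hSab : Set.Icc a b ⊆ S) (hint : ∀ s ∈ Set.Ioo a b, S ∈ nhds s)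
    (hle : ∀ s ∈ Set.Icc a b, ‖derivWithin x S s‖ ≤ v₀) :
    ∃ C, ∀ p : R3, p ≠ 0 →
      ‖(∫ s in a..b, Complex.exp (Complex.I * (phase x p s : ℂ)) •
          complexify (derivWithin x S s)) -
        (-Complex.I) • (Complex.exp (Complex.I * (phase x p b : ℂ)) •
            complexify (boundaryVec p (derivWithin x S b)) -
          Complex.exp (Complex.I * (phase x p a : ℂ)) •
            complexify (boundaryVec p (derivWithin x S a)))‖ ≤
        C / ‖p‖ ^ 2 := by
  have hv : ContDiffOn ℝ 2 (derivWithin x S) S := hx.derivWithin hS (by norm_num)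
  have hv₁ : ContDiffOn ℝ 1 (derivWithin (derivWithin x S) S) S := hv.derivWithin hS (by norm_num)
  have hv₂ : ContDiffOn ℝ 0 (derivWithin (derivWithin (derivWithin x S) S) S) S :=
    hv₁.derivWithin hS (by norm_num)
  have hd : ∀ (f : ℝ → R3) (n : WithTop ℕ∞), n ≠ 0 → ContDiffOn ℝ n f S →
      ∀ s ∈ Set.Ioo a b, HasDerivAt f (derivWithin f S s) s := fun f n hn hf s hs =>
    ((hf.differentiableOn hn s (hSab (Set.Ioo_subset_Icc_self hs))).hasDerivWithinAt).hasDerivAt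
      (hint s hs)
  exact exists_norm_oscillatory_sub_le hab hv₀ (hx.continuousOn.mono hSab)
    (hv.continuousOn.mono hSab) (hv₁.continuousOn.mono hSab) (hv₂.continuousOn.mono hSab)
    (hd _ 3 (by norm_num) hx) (hd _ 2 (by norm_num) hv) (hd _ 1 (by norm_num) hv₁) hle

theorem continuousOn_derivWithin_of_contDiffOn {x : ℝ → R3} {S : Set ℝ} (hS : UniqueDiffOn ℝ S)
    (hx : ContDiffOn ℝ 3 x S) : ContinuousOn (derivWithin x S) S :=
  hx.continuousOn_derivWithin hS (by norm_num)

/-- The speed bound is assumed only off `0`; continuity of the one-sided derivative carries it to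
`0`. -/
theorem norm_derivWithin_Ici_le {x : ℝ → R3} {v₀ : ℝ} (hplus : ContDiffOn ℝ 3 x (Set.Ici 0))
    (hspeed : ∀ t : ℝ, t ≠ 0 → ‖deriv x t‖ ≤ v₀) {s : ℝ} (hs : 0 ≤ s) :
    ‖derivWithin x (Set.Ici 0) s‖ ≤ v₀ := by
  have hc := (continuousOn_derivWithin_of_contDiffOn (uniqueDiffOn_Ici 0) hplus).norm
  have hle : ∀ t ∈ Set.Ioi (0 : ℝ), ‖derivWithin x (Set.Ici 0) t‖ ≤ v₀ := fun t ht => by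
    rw [derivWithin_of_mem_nhds (Ici_mem_nhds ht)]
    exact hspeed t (ne_of_gt ht)
  have hcl : closure (Set.Ioi (0 : ℝ)) = Set.Ici 0 := closure_Ioi 0
  exact le_on_closure (f := fun t => ‖derivWithin x (Set.Ici 0) t‖) (g := fun _ => v₀) hle
    (by rwa [hcl]) continuousOn_const (by rw [hcl]; exact hs)

theorem norm_derivWithin_Iic_le {x : ℝ → R3} {v₀ : ℝ} (hminus : ContDiffOn ℝ 3 x (Set.Iic 0))
    (hspeed : ∀ t : ℝ, t ≠ 0 → ‖deriv x t‖ ≤ v₀) {s : ℝ} (hs : s ≤ 0) :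
    ‖derivWithin x (Set.Iic 0) s‖ ≤ v₀ := by
  have hc := (continuousOn_derivWithin_of_contDiffOn (uniqueDiffOn_Iic 0) hminus).norm
  have hle : ∀ t ∈ Set.Iio (0 : ℝ), ‖derivWithin x (Set.Iic 0) t‖ ≤ v₀ := fun t ht => by
    rw [derivWithin_of_mem_nhds (Iic_mem_nhds ht)]
    exact hspeed t (ne_of_lt ht)
  have hcl : closure (Set.Iio (0 : ℝ)) = Set.Iic 0 := closure_Iio 0
  exact le_on_closure (f := fun t => ‖derivWithin x (Set.Iic 0) t‖) (g := fun _ => v₀) hle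
    (by rwa [hcl]) continuousOn_const (by rw [hcl]; exact hs)

/-- The asymptotics of `J` for a trajectory with a jump of the velocity at `t = 0`. -/
theorem exists_norm_J_sub_le {x : ℝ → R3} {v₀ : ℝ} (hcont : Continuous x)
    (hminus : ContDiffOn ℝ 3 x (Set.Iic 0)) (hplus : ContDiffOn ℝ 3 x (Set.Ici 0))
    (hsupp : HasCompactSupport (deriv x)) (hspeed : ∀ t : ℝ, t ≠ 0 → ‖deriv x t‖ ≤ v₀)
    (hv₀ : v₀ < 1) :
    ∃ C, ∀ p : R3, p ≠ 0 →
      ‖J x p - (-(((2 * Real.pi) ^ (-(3 / 2) : ℝ) : ℝ) : ℂ) *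
          Complex.exp (Complex.I * (phase x p 0 : ℂ))) •
        complexify (boundaryVec p (velMinus x) - boundaryVec p (velPlus x))‖ ≤ C / ‖p‖ ^ 2 := by
  obtain ⟨T, hT0, hT⟩ : ∃ T : ℝ, 0 < T ∧ ∀ s, T ≤ |s| → deriv x s = 0 := by
    obtain ⟨T, hT⟩ := hsupp.isCompact.isBounded.exists_norm_le
    refine ⟨|T| + 1, by positivity, fun s hs => image_eq_zero_of_notMem_tsupport fun hmem => ?_⟩
    have h1 := hT s hmem
    rw [Real.norm_eq_abs] at h1
    linarith [le_abs_self T]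
  have hP : ∀ s, 0 < s → derivWithin x (Set.Ici 0) s = deriv x s := fun s hs =>
    derivWithin_of_mem_nhds (Ici_mem_nhds hs)
  have hM : ∀ s, s < 0 → derivWithin x (Set.Iic 0) s = deriv x s := fun s hs =>
    derivWithin_of_mem_nhds (Iic_mem_nhds hs)
  obtain ⟨C₁, hC₁⟩ := exists_norm_oscillatory_sub_le_of_contDiffOn (a := -T) (b := 0)
    (by linarith) hv₀ (uniqueDiffOn_Iic 0) hminus (fun s hs => hs.2)
    (fun s hs => Iic_mem_nhds hs.2) (fun s hs => norm_derivWithin_Iic_le hminus hspeed hs.2)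
  obtain ⟨C₂, hC₂⟩ := exists_norm_oscillatory_sub_le_of_contDiffOn (a := 0) (b := T)
    hT0.le hv₀ (uniqueDiffOn_Ici 0) hplus (fun s hs => hs.1)
    (fun s hs => Ici_mem_nhds hs.1) (fun s hs => norm_derivWithin_Ici_le hplus hspeed hs.1)
  set k : ℝ := (2 * Real.pi) ^ (-(3 / 2) : ℝ) with hk
  have hk0 : 0 ≤ k := by positivity
  refine ⟨k * (C₁ + C₂), fun p hp => ?_⟩
  have h1 := hC₁ p hp
  have h2 := hC₂ p hp
  -- The velocity vanishes at `±T`, so of the four boundary terms only the two at `t = 0` remain.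
  have hMT : derivWithin x (Set.Iic 0) (-T) = 0 := by
    rw [hM _ (by linarith), hT]
    rw [abs_neg, abs_of_pos hT0]
  have hPT : derivWithin x (Set.Ici 0) T = 0 := by
    rw [hP _ hT0, hT]
    rw [abs_of_pos hT0]
  have hb0 : ∀ p, complexify (boundaryVec p 0) = 0 := fun p => by
    rw [boundaryVec, smul_zero]
    exact map_zero complexifyL
  rw [hMT, hb0, smul_zero, sub_zero] at h1
  rw [hPT, hb0, smul_zero, zero_sub] at h2
  have hec : Continuous fun s => Complex.exp (Complex.I * (phase x p s : ℂ)) := by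
    unfold phase
    fun_prop
  have e1 : Set.EqOn (fun s => Complex.exp (Complex.I * (phase x p s : ℂ)) •
      complexify (derivWithin x (Set.Iic 0) s))
      (fun s => Complex.exp (Complex.I * (phase x p s : ℂ)) • complexify (deriv x s))
      (Set.Ioo (-T) 0) := fun s hs => by simp only [hM s hs.2]
  have e2 : Set.EqOn (fun s => Complex.exp (Complex.I * (phase x p s : ℂ)) •
      complexify (derivWithin x (Set.Ici 0) s))
      (fun s => Complex.exp (Complex.I * (phase x p s : ℂ)) • complexify (deriv x s))
      (Set.Ioo 0 T) := fun s hs => by simp only [hP s hs.1]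
  have i1 : IntervalIntegrable (fun s => Complex.exp (Complex.I * (phase x p s : ℂ)) •
      complexify (derivWithin x (Set.Iic 0) s)) volume (-T) 0 :=
    (hec.continuousOn.smul (continuous_complexify.comp_continuousOn
      ((continuousOn_derivWithin_of_contDiffOn (uniqueDiffOn_Iic 0) hminus).mono
        fun s hs => hs.2))).intervalIntegrable_of_Icc (by linarith)
  have i2 : IntervalIntegrable (fun s => Complex.exp (Complex.I * (phase x p s : ℂ)) •
      complexify (derivWithin x (Set.Ici 0) s)) volume 0 T :=
    (hec.continuousOn.smul (continuous_complexify.comp_continuousOn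
      ((continuousOn_derivWithin_of_contDiffOn (uniqueDiffOn_Ici 0) hplus).mono
        fun s hs => hs.1))).intervalIntegrable_of_Icc hT0.le
  have hsplit : ∫ s : ℝ, Complex.exp (Complex.I * (phase x p s : ℂ)) • complexify (deriv x s) =
      (∫ s in (-T)..0, Complex.exp (Complex.I * (phase x p s : ℂ)) •
        complexify (derivWithin x (Set.Iic 0) s)) +
      ∫ s in (0 : ℝ)..T, Complex.exp (Complex.I * (phase x p s : ℂ)) •
        complexify (derivWithin x (Set.Ici 0) s) := by
    rw [intervalIntegral.integral_congr_Ioo_of_le (by linarith) e1,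
      intervalIntegral.integral_congr_Ioo_of_le hT0.le e2,
      intervalIntegral.integral_add_adjacent_intervals
        (i1.congr_uIoo (by rwa [Set.uIoo_of_le (by linarith)]))
        (i2.congr_uIoo (by rwa [Set.uIoo_of_le hT0.le]))]
    refine (intervalIntegral.integral_eq_integral_of_support_subset fun s hs => ?_).symm
    by_contra hc
    refine hs ?_
    have : T ≤ |s| := by
      rw [Set.mem_Ioc, not_and_or, not_lt, not_le] at hc
      rcases hc with hc | hc
      · exact le_abs.mpr (Or.inr (by linarith))
      · exact le_abs.mpr (Or.inl hc.le)
    simp only [hT s this]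
    rw [show complexify 0 = 0 from map_zero complexifyL, smul_zero]
  have hsub : complexify (boundaryVec p (velMinus x) - boundaryVec p (velPlus x)) =
      complexify (boundaryVec p (velMinus x)) - complexify (boundaryVec p (velPlus x)) :=
    map_sub complexifyL _ _
  rw [J, hsplit, hsub]
  change ‖_ - (-Complex.I) • Complex.exp (Complex.I * (phase x p 0 : ℂ)) •
    complexify (boundaryVec p (velMinus x))‖ ≤ _ at h1
  change ‖_ - (-Complex.I) • -(Complex.exp (Complex.I * (phase x p 0 : ℂ)) •
    complexify (boundaryVec p (velPlus x)))‖ ≤ _ at h2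
  generalize (∫ s in (-T)..0, Complex.exp (Complex.I * (phase x p s : ℂ)) •
    complexify (derivWithin x (Set.Iic 0) s)) = I₁ at h1 ⊢
  generalize (∫ s in (0 : ℝ)..T, Complex.exp (Complex.I * (phase x p s : ℂ)) •
    complexify (derivWithin x (Set.Ici 0) s)) = I₂ at h2 ⊢
  generalize Complex.exp (Complex.I * (phase x p 0 : ℂ)) = ε at h1 h2 ⊢
  generalize complexify (boundaryVec p (velMinus x)) = y at h1 ⊢
  generalize complexify (boundaryVec p (velPlus x)) = z at h2 ⊢
  -- The last summand is zero because `i² = -1`; it is kept explicit so that the identity is purely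
  -- linear and `module` can prove it.
  have h3 : (-Complex.I * (k : ℂ)) • (I₁ + I₂) - (-(k : ℂ) * ε) • (y - z) =
      (-Complex.I * (k : ℂ)) • ((I₁ - (-Complex.I) • ε • y) + (I₂ - (-Complex.I) • -(ε • z))) +
      ((1 + Complex.I * Complex.I) * (k : ℂ) * ε) • (y - z) := by module
  rw [h3, Complex.I_mul_I, add_neg_cancel, zero_mul, zero_mul, zero_smul, add_zero, norm_smul,
    norm_mul, norm_neg, Complex.norm_I, one_mul, Complex.norm_real, Real.norm_of_nonneg hk0,
    mul_div_assoc, add_div]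
  gcongr
  exact (norm_add_le _ _).trans (add_le_add h1 h2)

/-! ### The transverse boundary term and the square integrable remainder -/

theorem boundaryT_eq (x : ℝ → R3) (p : R3) :
    boundaryT x p = transverse p ((-(((2 * Real.pi) ^ (-(3 / 2) : ℝ) : ℝ) : ℂ) *
      Complex.exp (Complex.I * (phase x p 0 : ℂ))) •
        complexify (boundaryVec p (velMinus x) - boundaryVec p (velPlus x))) :=
  (map_smul (transverse p) _ _).symm

theorem measurable_boundaryT (x : ℝ → R3) : Measurable (boundaryT x) := by
  have h : (boundaryT x) = fun p => transverse p ((-(((2 * Real.pi) ^ (-(3 / 2) : ℝ) : ℝ) : ℂ) *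
      Complex.exp (Complex.I * (phase x p 0 : ℂ))) •
        complexify (boundaryVec p (velMinus x) - boundaryVec p (velPlus x))) :=
    funext (boundaryT_eq x)
  rw [h]
  have h1 : Measurable fun p : R3 => -(((2 * Real.pi) ^ (-(3 / 2) : ℝ) : ℝ) : ℂ) *
      Complex.exp (Complex.I * (phase x p 0 : ℂ)) := by
    unfold phase
    fun_prop
  have h2 : Measurable fun p : R3 => boundaryVec p (velMinus x) - boundaryVec p (velPlus x) := by
    unfold boundaryVec
    fun_prop
  exact measurable_transverse (h1.smul (continuous_complexify.measurable.comp h2))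

theorem measurableSet_one_le_norm : MeasurableSet {p : R3 | 1 ≤ ‖p‖} :=
  (isClosed_le continuous_const continuous_norm).measurableSet

theorem memLp_JT_sub_boundaryT {x : ℝ → R3} {v₀ : ℝ} (hcont : Continuous x)
    (hminus : ContDiffOn ℝ 3 x (Set.Iic 0)) (hplus : ContDiffOn ℝ 3 x (Set.Ici 0))
    (hsupp : HasCompactSupport (deriv x)) (hspeed : ∀ t : ℝ, t ≠ 0 → ‖deriv x t‖ ≤ v₀)
    (hv₀ : v₀ < 1) :
    MemLp (fun p => JT x p - boundaryT x p) 2 (photonMeasure.restrict {p | 1 ≤ ‖p‖}) := by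
  obtain ⟨C, hC⟩ := exists_norm_J_sub_le hcont hminus hplus hsupp hspeed hv₀
  -- The `2` comes from `norm_transverse_le`, the `4` from `(1 + |p|²)² ≤ 4 |p|⁴` for `|p| ≥ 1`.
  refine memLp_two_of_norm_sq_le (C := (2 * C) ^ 2 * 4) measurableSet_one_le_norm
    ((measurable_JT hcont).sub (measurable_boundaryT x)).aestronglyMeasurable fun p hp hp0 => ?_
  have h1 : ‖JT x p - boundaryT x p‖ ≤ 2 * (C / ‖p‖ ^ 2) := by
    rw [JT, boundaryT_eq, ← map_sub]
    exact (norm_transverse_le _ _).trans (by gcongr; exact hC p hp0)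
  have hp1 : 1 ≤ ‖p‖ := hp
  rw [le_mul_inv_iff₀ (by positivity)]
  calc ‖JT x p - boundaryT x p‖ ^ 2 * (1 + ‖p‖ ^ 2) ^ 2
      ≤ (2 * (C / ‖p‖ ^ 2)) ^ 2 * (‖p‖ ^ 2 + ‖p‖ ^ 2) ^ 2 := by
        gcongr
        exact one_le_pow₀ hp1
    _ = (2 * C) ^ 2 * 4 := by
        field_simp
        ring

end PointSource


namespace PointSource

/-! ### The ultraviolet divergence -/

theorem boundaryVec_smul_left {c : ℝ} (hc : 0 < c) (p v : R3) :
    boundaryVec (c • p) v = c⁻¹ • boundaryVec p v := by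
  rw [boundaryVec, boundaryVec, norm_smul, Real.norm_of_nonneg hc.le, real_inner_smul_left,
    ← mul_sub, mul_inv, smul_smul]

theorem norm_boundaryT (x : ℝ → R3) (p : R3) :
    ‖boundaryT x p‖ = (2 * Real.pi) ^ (-(3 / 2) : ℝ) *
      ‖transverse p (complexify (boundaryVec p (velMinus x) - boundaryVec p (velPlus x)))‖ := by
  rw [boundaryT_eq, map_smul, norm_smul, norm_mul, norm_exp_phase, norm_neg, Complex.norm_real,
    Real.norm_of_nonneg (by positivity), mul_one]

/-- The phase drops out of the norm, the projection depends only on the direction of `p`, and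
`boundaryVec` has degree `-1`. -/
theorem norm_boundaryT_smul (x : ℝ → R3) {c : ℝ} (hc : 0 < c) (p : R3) :
    ‖boundaryT x (c • p)‖ = c⁻¹ * ‖boundaryT x p‖ := by
  have h : complexify (c⁻¹ • (boundaryVec p (velMinus x) - boundaryVec p (velPlus x))) =
      ((c⁻¹ : ℝ) : ℂ) • complexify (boundaryVec p (velMinus x) - boundaryVec p (velPlus x)) :=
    complexifyL.map_smul _ _
  rw [norm_boundaryT, norm_boundaryT, transverse_smul_left hc.ne', boundaryVec_smul_left hc,
    boundaryVec_smul_left hc, ← smul_sub, h, map_smul, norm_smul, Complex.norm_real,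
    Real.norm_of_nonneg (by positivity)]
  ring

/-- A linear map from a three dimensional space to the plane has a kernel. In such a direction both
denominators reduce to `|p|`, and the difference of the velocities is already transverse. -/
theorem exists_norm_eq_one_orthogonal (u v : R3) :
    ∃ n : R3, ‖n‖ = 1 ∧ ⟪n, u⟫_ℝ = 0 ∧ ⟪n, v⟫_ℝ = 0 := by
  let f : R3 →ₗ[ℝ] ℝ × ℝ := (innerₗ R3 u).prod (innerₗ R3 v)
  have hker : LinearMap.ker f ≠ ⊥ := LinearMap.ker_ne_bot_of_finrank_lt (by simp)
  obtain ⟨w, hw, hw0⟩ := Submodule.exists_mem_ne_zero_of_ne_bot hker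
  have hw' : (⟪u, w⟫_ℝ, ⟪v, w⟫_ℝ) = (0, 0) := hw
  rw [Prod.mk.injEq] at hw'
  refine ⟨‖w‖⁻¹ • w, ?_, ?_, ?_⟩
  · rw [norm_smul, norm_inv, norm_norm, inv_mul_cancel₀ (norm_ne_zero_iff.mpr hw0)]
  · rw [real_inner_smul_left, real_inner_comm, hw'.1, mul_zero]
  · rw [real_inner_smul_left, real_inner_comm, hw'.2, mul_zero]

theorem continuousAt_norm_boundaryT {x : ℝ → R3} {p : R3} (hp : p ≠ 0)
    (h1 : ‖p‖ - ⟪p, velMinus x⟫_ℝ ≠ 0) (h2 : ‖p‖ - ⟪p, velPlus x⟫_ℝ ≠ 0) :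
    ContinuousAt (fun q => ‖boundaryT x q‖) p := by
  have hv : ∀ v : R3, ‖p‖ - ⟪p, v⟫_ℝ ≠ 0 → ContinuousAt (fun q => boundaryVec q v) p :=
    fun v hv => ((by fun_prop : ContinuousAt (fun q : R3 => ‖q‖ - ⟪q, v⟫_ℝ) p).inv₀ hv).smul
      continuousAt_const
  have hc : ContinuousAt (fun q => complexify (boundaryVec q (velMinus x) -
      boundaryVec q (velPlus x))) p :=
    continuous_complexify.continuousAt.comp ((hv _ h1).sub (hv _ h2))
  have hn : ContinuousAt (fun q : R3 => (((‖q‖ ^ 2)⁻¹ : ℝ) : ℂ)) p :=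
    Complex.continuous_ofReal.continuousAt.comp
      ((by fun_prop : ContinuousAt (fun q : R3 => ‖q‖ ^ 2) p).inv₀ (by simpa using hp))
  simp only [norm_boundaryT, transverse_eq]
  exact continuousAt_const.mul (hc.sub ((hn.mul (ContinuousAt.inner (𝕜 := ℂ) continuous_complexify.continuousAt hc)).smul
    continuous_complexify.continuousAt)).norm

/-- The boundary term is homogeneous of degree `-1`, so that it is not square integrable at
infinity unless it vanishes; it does not vanish in the directions orthogonal to the velocities. -/
theorem not_memLp_boundaryT {x : ℝ → R3} (hjump : velMinus x ≠ velPlus x) :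
    ¬ MemLp (boundaryT x) 2 (photonMeasure.restrict {p | 1 ≤ ‖p‖}) := by
  intro hmem
  set N : R3 → ℝ := fun p => (2 * ‖p‖)⁻¹ * ‖boundaryT x p‖ ^ 2 with hN
  have hN0 : ∀ p, 0 ≤ N p := fun p => by positivity
  -- A factor `1/2` comes from the density and `1/4` from the squared norm; together they match the
  -- Jacobian `2⁻³` of the dilation.
  have hN2 : ∀ p, N ((2 : ℝ) • p) = 8⁻¹ * N p := fun p => by
    simp only [hN]
    rw [norm_boundaryT_smul x two_pos, norm_smul, Real.norm_of_nonneg two_pos.le, mul_pow]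
    simp only [mul_inv]
    ring
  set Φ : R3 → ℝ := Set.indicator {p | 1 ≤ ‖p‖} N with hΦ
  set Ψ : R3 → ℝ := Set.indicator {p | 1 / 2 ≤ ‖p‖} N with hΨ
  have hΦint : Integrable Φ := by
    rw [memLp_two_iff_integrable_sq_norm (measurable_boundaryT x).aestronglyMeasurable] at hmem
    have h1 : IntegrableOn (fun p => ‖boundaryT x p‖ ^ 2) {p | 1 ≤ ‖p‖} photonMeasure := hmem
    rw [← integrable_indicator_iff measurableSet_one_le_norm, integrable_photonMeasure_iff] at h1
    refine h1.congr (Filter.Eventually.of_forall fun p => ?_)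
    simp only [hΦ, Set.indicator_apply, smul_eq_mul, mul_ite, mul_zero, hN]
  have hΦΨ : (fun p => Φ ((2 : ℝ) • p)) = fun p => 8⁻¹ * Ψ p := by
    funext p
    simp only [hΦ, hΨ, Set.indicator_apply, Set.mem_ofPred_eq, norm_smul,
      Real.norm_of_nonneg (zero_le_two : (0 : ℝ) ≤ 2), hN2, mul_ite, mul_zero]
    exact if_congr (by constructor <;> intro h <;> linarith) rfl rfl
  have hΨint : Integrable Ψ := by
    have h1 := (integrable_comp_smul_iff (volume : Measure R3) Φ (two_ne_zero' ℝ)).mpr hΦint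
    rw [hΦΨ] at h1
    have h2 := h1.const_mul 8
    refine h2.congr (Filter.Eventually.of_forall fun p => ?_)
    simp only
    ring
  -- By dilation invariance the finite integrals over `|p| ≥ 1/2` and `|p| ≥ 1` agree, so the shell
  -- between them has mass zero. This is contradicted at `p₀`, inside the shell.
  have heq : ∫ p, Ψ p = ∫ p, Φ p := by
    have h1 := Measure.integral_comp_smul (volume : Measure R3) Φ 2
    rw [hΦΨ, integral_const_mul] at h1
    have hd : Module.finrank ℝ R3 = 3 := by simp
    rw [hd, smul_eq_mul] at h1
    norm_num at h1
    linarith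
  have hzero : ∫ p, (Ψ p - Φ p) = 0 := by rw [integral_sub hΨint hΦint, heq, sub_self]
  have hle : ∀ p, 0 ≤ Ψ p - Φ p := fun p => by
    rw [sub_nonneg]
    exact Set.indicator_le_indicator_of_subset
      (fun q (hq : 1 ≤ ‖q‖) => (by norm_num : (1 / 2 : ℝ) ≤ 1).trans hq) hN0 p
  have hae := (integral_eq_zero_iff_of_nonneg hle (hΨint.sub hΦint)).mp hzero
  obtain ⟨n, hn1, hnm, hnp⟩ := exists_norm_eq_one_orthogonal (velMinus x) (velPlus x)
  set p₀ : R3 := (3 / 4 : ℝ) • n with hp₀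
  have hp₀n : ‖p₀‖ = 3 / 4 := by rw [hp₀, norm_smul, hn1]; norm_num
  have hp₀0 : p₀ ≠ 0 := norm_ne_zero_iff.mp (by rw [hp₀n]; norm_num)
  have hm : ⟪p₀, velMinus x⟫_ℝ = 0 := by rw [hp₀, real_inner_smul_left, hnm, mul_zero]
  have hp : ⟪p₀, velPlus x⟫_ℝ = 0 := by rw [hp₀, real_inner_smul_left, hnp, mul_zero]
  have hNc : ContinuousAt N p₀ := by
    have h1 : ContinuousAt (fun q : R3 => (2 * ‖q‖)⁻¹) p₀ :=
      (by fun_prop : ContinuousAt (fun q : R3 => 2 * ‖q‖) p₀).inv₀ (by rw [hp₀n]; norm_num)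
    exact h1.mul ((continuousAt_norm_boundaryT hp₀0 (by rw [hp₀n, hm]; norm_num)
      (by rw [hp₀n, hp]; norm_num)).pow 2)
  have hNpos : 0 < N p₀ := by
    have hw : boundaryVec p₀ (velMinus x) - boundaryVec p₀ (velPlus x) =
        (3 / 4 : ℝ)⁻¹ • (velMinus x - velPlus x) := by
      rw [boundaryVec, boundaryVec, hm, hp, hp₀n, sub_zero, smul_sub]
    have hb : 0 < ‖boundaryT x p₀‖ := by
      rw [norm_boundaryT, hw, transverse_eq, inner_complexify, real_inner_smul_right,
        inner_sub_right, hm, hp]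
      simp only [sub_zero, mul_zero, Complex.ofReal_zero, zero_smul, norm_complexify, norm_smul]
      have : 0 < ‖velMinus x - velPlus x‖ := norm_pos_iff.mpr (sub_ne_zero.mpr hjump)
      exact mul_pos (by positivity) (mul_pos (by norm_num) this)
    simp only [hN]
    rw [hp₀n]
    positivity
  have hnhds : {p | Ψ p - Φ p ≠ 0} ∈ nhds p₀ := by
    have h1 : ∀ᶠ p in nhds p₀, 0 < N p := hNc.eventually (lt_mem_nhds hNpos)
    have h2 : ∀ᶠ p in nhds p₀, 1 / 2 < ‖p‖ :=
      continuous_norm.continuousAt.eventually (lt_mem_nhds (by simp only [hp₀n]; norm_num))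
    have h3 : ∀ᶠ p in nhds p₀, ‖p‖ < 1 :=
      continuous_norm.continuousAt.eventually (gt_mem_nhds (by simp only [hp₀n]; norm_num))
    filter_upwards [h1, h2, h3] with p hp1 hp2 hp3
    simp only [hΦ, hΨ]
    rw [Set.indicator_of_mem (show p ∈ {p : R3 | 1 / 2 ≤ ‖p‖} from hp2.le),
      Set.indicator_of_notMem (show p ∉ {p : R3 | 1 ≤ ‖p‖} from not_le.mpr hp3), sub_zero]
    exact hp1.ne'
  exact (Measure.measure_pos_of_mem_nhds volume hnhds).ne' hae

theorem not_memLp_JT {x : ℝ → R3} {v₀ : ℝ} (hcont : Continuous x)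
    (hminus : ContDiffOn ℝ 3 x (Set.Iic 0)) (hplus : ContDiffOn ℝ 3 x (Set.Ici 0))
    (hjump : velMinus x ≠ velPlus x)
    (hsupp : HasCompactSupport (deriv x)) (hspeed : ∀ t : ℝ, t ≠ 0 → ‖deriv x t‖ ≤ v₀)
    (hv₀ : v₀ < 1) : ¬ MemLp (JT x) 2 photonMeasure := by
  intro h
  have h1 := (h.restrict {p : R3 | 1 ≤ ‖p‖}).sub
    (memLp_JT_sub_boundaryT hcont hminus hplus hsupp hspeed hv₀)
  refine not_memLp_boundaryT hjump (h1.ae_eq (Filter.Eventually.of_forall fun p => ?_))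
  simp

end PointSource


/-! ### Pointwise limits of `*`-automorphisms -/

section PointwiseLimit

variable {A : Type*} [CStarAlgebra A]

theorem StarAlgHom.norm_map_le (T : A →⋆ₐ[ℂ] A) (a : A) : ‖T a‖ ≤ ‖a‖ :=
  NonUnitalStarAlgHom.norm_apply_le T a

/-- The elements of a `C*`-algebra at which a sequence of `*`-homomorphisms converges to an element
of a given closed `*`-subalgebra. -/
def convergenceSubalgebra (S : StarSubalgebra ℂ A) (T : ℕ → A →⋆ₐ[ℂ] A) : StarSubalgebra ℂ A where
  carrier := {a | ∃ b ∈ S, Filter.Tendsto (fun n => T n a) Filter.atTop (nhds b)}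
  mul_mem' := by
    rintro a a' ⟨b, hb, h⟩ ⟨b', hb', h'⟩
    exact ⟨b * b', mul_mem hb hb', by simpa only [map_mul] using h.mul h'⟩
  add_mem' := by
    rintro a a' ⟨b, hb, h⟩ ⟨b', hb', h'⟩
    exact ⟨b + b', add_mem hb hb', by simpa only [map_add] using h.add h'⟩
  algebraMap_mem' c := ⟨algebraMap ℂ A c, S.algebraMap_mem c, by
    simpa only [AlgHomClass.commutes] using tendsto_const_nhds⟩
  star_mem' := by
    rintro a ⟨b, hb, h⟩
    exact ⟨star b, star_mem hb, by simpa only [map_star] using h.star⟩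

/-- The homomorphisms are contractive, so approximation of `a` by `a'` is uniform in `n`. This makes
the images of `a` a Cauchy sequence and places its limit in the closure of `S`. -/
theorem isClosed_convergenceSubalgebra {S : StarSubalgebra ℂ A} (hS : IsClosed (S : Set A))
    (T : ℕ → A →⋆ₐ[ℂ] A) : IsClosed (convergenceSubalgebra S T : Set A) := by
  refine isClosed_of_closure_subset fun a ha => ?_
  rw [Metric.mem_closure_iff] at ha
  have hcau : CauchySeq fun n => T n a := by
    rw [Metric.cauchySeq_iff']
    intro ε hε
    obtain ⟨a', ⟨b', -, hb'⟩, haa'⟩ := ha (ε / 3) (by positivity)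
    obtain ⟨N, hN⟩ := (Metric.cauchySeq_iff'.mp hb'.cauchySeq) (ε / 3) (by positivity)
    refine ⟨N, fun n hn => ?_⟩
    have h1 : ∀ m, dist (T m a) (T m a') < ε / 3 := fun m => by
      rw [dist_eq_norm, ← map_sub]
      exact ((T m).norm_map_le _).trans_lt (by rwa [← dist_eq_norm])
    have h2 := dist_triangle4 (T n a) (T n a') (T N a') (T N a)
    have h3 := h1 N
    rw [dist_comm] at h3
    linarith [h1 n, hN n hn]
  obtain ⟨b, hb⟩ := cauchySeq_tendsto_of_complete hcau
  refine ⟨b, ?_, hb⟩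
  rw [← SetLike.mem_coe, ← hS.closure_eq, Metric.mem_closure_iff]
  intro ε hε
  obtain ⟨a', ⟨b', hb'S, hb'⟩, haa'⟩ := ha (ε / 2) (by positivity)
  refine ⟨b', hb'S, ?_⟩
  have h1 : dist b b' ≤ ε / 2 := by
    refine le_of_tendsto (hb.dist hb') (Filter.Eventually.of_forall fun n => ?_)
    rw [dist_eq_norm, ← map_sub]
    exact ((T n).norm_map_le _).trans (by rw [← dist_eq_norm]; exact haa'.le)
  linarith

/-- A sequence of `*`-homomorphisms which converges on generators converges pointwise on the
generated `C*`-algebra to a `*`-homomorphism. -/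
theorem exists_starAlgHom_of_tendsto {s : Set A} {T : ℕ → A →⋆ₐ[ℂ] A}
    (h : ∀ a ∈ s, ∃ b ∈ (StarAlgebra.adjoin ℂ s).topologicalClosure,
      Filter.Tendsto (fun n => T n a) Filter.atTop (nhds b)) :
    ∃ φ : (StarAlgebra.adjoin ℂ s).topologicalClosure →⋆ₐ[ℂ]
        (StarAlgebra.adjoin ℂ s).topologicalClosure,
      ∀ a : (StarAlgebra.adjoin ℂ s).topologicalClosure,
        Filter.Tendsto (fun n => T n a) Filter.atTop (nhds (φ a : A)) := by
  -- The elements with convergent images form a closed `*`-subalgebra containing the generators,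
  -- hence the whole generated algebra.
  have hle : (StarAlgebra.adjoin ℂ s).topologicalClosure ≤
      convergenceSubalgebra (StarAlgebra.adjoin ℂ s).topologicalClosure T :=
    StarSubalgebra.topologicalClosure_minimal (StarAlgebra.adjoin_le h)
      (isClosed_convergenceSubalgebra (StarSubalgebra.isClosed_topologicalClosure _) T)
  choose f hfS hf using fun a : (StarAlgebra.adjoin ℂ s).topologicalClosure => hle a.2
  refine ⟨{ toFun := fun a => ⟨f a, hfS a⟩, map_one' := ?_, map_mul' := ?_, map_zero' := ?_,
            map_add' := ?_, commutes' := ?_, map_star' := ?_ }, hf⟩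
  · refine Subtype.ext (tendsto_nhds_unique (hf 1) ?_)
    simpa only [OneMemClass.coe_one, map_one] using tendsto_const_nhds
  · intro a b
    refine Subtype.ext (tendsto_nhds_unique (hf (a * b)) ?_)
    simpa only [MulMemClass.coe_mul, map_mul] using (hf a).mul (hf b)
  · refine Subtype.ext (tendsto_nhds_unique (hf 0) ?_)
    simpa only [ZeroMemClass.coe_zero, map_zero] using tendsto_const_nhds
  · intro a b
    refine Subtype.ext (tendsto_nhds_unique (hf (a + b)) ?_)
    simpa only [AddMemClass.coe_add, map_add] using (hf a).add (hf b)
  · intro c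
    refine Subtype.ext (tendsto_nhds_unique (hf (algebraMap ℂ _ c)) ?_)
    have : ∀ n, T n (algebraMap ℂ A c) = algebraMap ℂ A c := fun n => AlgHomClass.commutes (T n) c
    simpa only [SubalgebraClass.coe_algebraMap, this] using tendsto_const_nhds
  · intro a
    refine Subtype.ext (tendsto_nhds_unique (hf (star a)) ?_)
    simpa only [StarMemClass.coe_star, map_star] using (hf a).star

/-- The `C*`-algebra generated by a set of elements of a `C*`-algebra. -/
abbrev generatedAlgebra (s : Set A) : StarSubalgebra ℂ A :=
  (StarAlgebra.adjoin ℂ s).topologicalClosure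

theorem mem_generatedAlgebra {s : Set A} {a : A} (ha : a ∈ s) : a ∈ generatedAlgebra s :=
  StarSubalgebra.le_topologicalClosure _ (StarAlgebra.subset_adjoin ℂ s ha)

theorem StarSubalgebra.continuous_starAlgHom {S : StarSubalgebra ℂ A} [IsClosed (S : Set A)]
    (φ : S →⋆ₐ[ℂ] S) : Continuous φ :=
  AddMonoidHomClass.continuous_of_bound φ 1 fun a => by
    rw [one_mul]
    exact NonUnitalStarAlgHom.norm_apply_le φ a

theorem generatedAlgebra_hom_ext {s : Set A} {φ ψ : generatedAlgebra s →⋆ₐ[ℂ] generatedAlgebra s}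
    (h : ∀ a (ha : a ∈ s), φ ⟨a, mem_generatedAlgebra ha⟩ = ψ ⟨a, mem_generatedAlgebra ha⟩) :
    φ = ψ := by
  have : IsClosed (generatedAlgebra s : Set A) := StarSubalgebra.isClosed_topologicalClosure _
  refine StarAlgHom.ext_topologicalClosure (StarSubalgebra.continuous_starAlgHom φ)
    (StarSubalgebra.continuous_starAlgHom ψ) (StarAlgHom.ext_adjoin ?_)
  rintro ⟨a, ha⟩ has
  exact h a has

/-- Phase rotations `W i ↦ c i • W i` of a family of generators extend to a unique automorphism of
the generated `C*`-algebra, if they and their inverses are pointwise limits of inner ones. -/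
theorem existsUnique_starAlgEquiv_of_tendsto {ι : Type*} {W : ι → A} {c : ι → ℂ}
    (hc : ∀ i, c i ≠ 0) {u v : ℕ → unitary A}
    (hu : ∀ i, Filter.Tendsto (fun n => (u n : A) * W i * star (u n : A)) Filter.atTop
      (nhds (c i • W i)))
    (hv : ∀ i, Filter.Tendsto (fun n => (v n : A) * W i * star (v n : A)) Filter.atTop
      (nhds ((c i)⁻¹ • W i))) :
    ∃! α : generatedAlgebra (Set.range W) ≃⋆ₐ[ℂ] generatedAlgebra (Set.range W),
      ∀ i, α ⟨W i, mem_generatedAlgebra ⟨i, rfl⟩⟩ =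
        c i • (⟨W i, mem_generatedAlgebra ⟨i, rfl⟩⟩ : generatedAlgebra (Set.range W)) := by
  have key : ∀ (d : ι → ℂ) (w : ℕ → unitary A),
      (∀ i, Filter.Tendsto (fun n => (w n : A) * W i * star (w n : A)) Filter.atTop
        (nhds (d i • W i))) →
      ∃ φ : generatedAlgebra (Set.range W) →⋆ₐ[ℂ] generatedAlgebra (Set.range W),
        ∀ i, φ ⟨W i, mem_generatedAlgebra ⟨i, rfl⟩⟩ =
          d i • (⟨W i, mem_generatedAlgebra ⟨i, rfl⟩⟩ : generatedAlgebra (Set.range W)) := by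
    intro d w hw
    obtain ⟨φ, hφ⟩ := exists_starAlgHom_of_tendsto (s := Set.range W)
      (T := fun n => (Unitary.conjStarAlgAut ℂ A (w n) : A →⋆ₐ[ℂ] A)) (by
        rintro _ ⟨i, rfl⟩
        exact ⟨d i • W i, SMulMemClass.smul_mem _ (mem_generatedAlgebra ⟨i, rfl⟩), hw i⟩)
    exact ⟨φ, fun i => Subtype.ext (tendsto_nhds_unique (hφ _) (hw i))⟩
  obtain ⟨φ, hφ⟩ := key c u hu
  obtain ⟨ψ, hψ⟩ := key (fun i => (c i)⁻¹) v hv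
  -- A limit of automorphisms need not be onto; here the limit for the inverse phases inverts it on
  -- generators, hence everywhere.
  refine ⟨StarAlgEquiv.ofStarAlgHom φ ψ ?_ ?_, hφ, fun β hβ => ?_⟩
  · refine generatedAlgebra_hom_ext ?_
    rintro _ ⟨i, rfl⟩
    simp only [StarAlgHom.comp_apply, StarAlgHom.coe_id, id_eq, hφ, hψ, map_smul, smul_smul]
    rw [mul_inv_cancel₀ (hc i), one_smul]
  · refine generatedAlgebra_hom_ext ?_
    rintro _ ⟨i, rfl⟩
    simp only [StarAlgHom.comp_apply, StarAlgHom.coe_id, id_eq, hφ, hψ, map_smul, smul_smul]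
    rw [inv_mul_cancel₀ (hc i), one_smul]
  · have h1 : (β : generatedAlgebra (Set.range W) →⋆ₐ[ℂ] generatedAlgebra (Set.range W)) = φ := by
      refine generatedAlgebra_hom_ext ?_
      rintro _ ⟨i, rfl⟩
      exact (hβ i).trans (hφ i).symm
    ext a
    exact congrArg Subtype.val (DFunLike.congr_fun h1 a)

/-- Since `w'` is a scalar multiple of `w`, membership is automatic, and the requirement on `α`
becomes an eigenvector equation for `w`. -/
theorem StarSubalgebra.starAlgEquiv_smul_iff {S : StarSubalgebra ℂ A} (α : S ≃⋆ₐ[ℂ] S) {w w' : A}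
    (hw : w ∈ S) {z : ℂ} (hw' : w' = Complex.exp (-z) • w) :
    (∃ h : w' ∈ S, (α ⟨w', h⟩ : A) = w) ↔ α ⟨w, hw⟩ = Complex.exp z • (⟨w, hw⟩ : S) := by
  have hmem : w' ∈ S := hw' ▸ SMulMemClass.smul_mem _ hw
  have hsm : (⟨w', hmem⟩ : S) = Complex.exp (-z) • (⟨w, hw⟩ : S) := Subtype.ext hw'
  rw [exists_prop_of_true hmem, hsm, map_smul]
  constructor
  · intro h1
    have h2 : Complex.exp (-z) • α ⟨w, hw⟩ = (⟨w, hw⟩ : S) := Subtype.ext h1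
    have h3 := congrArg (fun a => Complex.exp z • a) h2
    simpa only [smul_smul, ← Complex.exp_add, add_neg_cancel, Complex.exp_zero, one_smul] using h3
  · intro h1
    rw [h1, smul_smul, ← Complex.exp_add, neg_add_cancel, Complex.exp_zero, one_smul]

end PointwiseLimit

namespace PointSource

/-! ### The Weyl algebra -/

theorem weylIn_eq (h : S) : weylIn h = Fock.weyl (h : HT) := rfl

theorem fieldOut_eq (x : ℝ → R3) (h : S) :
    fieldOut x h = Fock.field (h : HT) +
      (-((Real.sqrt 2 * (pairing x h).re : ℝ) : ℂ)) • 1 := by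
  have h1 : (((Real.sqrt 2)⁻¹ : ℝ) : ℂ) * (pairing x h + (starRingEnd ℂ) (pairing x h)) =
      ((Real.sqrt 2 * (pairing x h).re : ℝ) : ℂ) := by
    rw [Complex.add_conj, ← Complex.ofReal_mul]
    congr 1
    have h2 : Real.sqrt 2 * Real.sqrt 2 = 2 := Real.mul_self_sqrt (by norm_num)
    have h3 : Real.sqrt 2 ≠ 0 := by positivity
    field_simp
    rw [sq, h2]
  rw [← h1]
  simp only [fieldOut, createOut, annihilateOut, createIn, annihilateIn, Fock.field]
  module

/-- The phase of `W_in(h)` relative to `W_out(h)`. -/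
theorem weylOut_eq (x : ℝ → R3) (h : S) :
    weylOut x h =
      Complex.exp (-(Complex.I * ((Real.sqrt 2 * (pairing x h).re : ℝ) : ℂ))) • weylIn h := by
  rw [weylOut, fieldOut_eq]
  have h1 := ((Fock.isExpI_weyl (h : HT)).add_smul_one (Fock.summable_norm_field_pow (h : HT))
    (-((Real.sqrt 2 * (pairing x h).re : ℝ) : ℂ))).expI_eq
  rw [mul_neg] at h1
  exact h1

theorem weylIn_mem (h : S) : weylIn h ∈ weylAlgebra :=
  StarSubalgebra.le_topologicalClosure _ (StarAlgebra.subset_adjoin ℂ _ ⟨h, rfl⟩)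

theorem isScatteringAut_iff (x : ℝ → R3) (α : weylAlgebra ≃⋆ₐ[ℂ] weylAlgebra) :
    IsScatteringAut x α ↔ ∀ h : S, α ⟨weylIn h, weylIn_mem h⟩ =
      Complex.exp (Complex.I * ((Real.sqrt 2 * (pairing x h).re : ℝ) : ℂ)) •
        (⟨weylIn h, weylIn_mem h⟩ : weylAlgebra) :=
  forall_congr' fun h =>
    StarSubalgebra.starAlgEquiv_smul_iff α (weylIn_mem h) (weylOut_eq x h)

end PointSource


namespace PointSource

/-! ### Infrared and ultraviolet cutoffs of the pairing -/

theorem memLp_indicator_JT {x : ℝ → R3} (hx : Continuous x) (R : ℝ) :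
    MemLp ((Metric.closedBall 0 R).indicator (JT x)) 2 photonMeasure :=
  (memLp_indicator_iff_restrict Metric.isClosed_closedBall.measurableSet).mpr
    (memLp_JT_closedBall hx R)

/-- The current `J_T` with momenta cut off at `|p| = R`, as an element of `𝒮`. -/
def cutoffJT {x : ℝ → R3} (hx : Continuous x) (R : ℝ) : S :=
  ⟨⟨(memLp_indicator_JT hx R).toLp, by
    filter_upwards [(memLp_indicator_JT hx R).coeFn_toLp] with p hp
    rw [hp]
    by_cases hpR : p ∈ Metric.closedBall 0 R
    · rw [Set.indicator_of_mem hpR]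
      exact transverse_transverse _ _
    · rw [Set.indicator_of_notMem hpR, map_zero]⟩, by
    intro k
    obtain ⟨C, hC⟩ := exists_norm_JT_le x
    have hC0 : 0 ≤ C := (norm_nonneg _).trans (hC 0)
    refine ⟨C * (1 + R ^ 2) ^ k, ?_⟩
    filter_upwards [(memLp_indicator_JT hx R).coeFn_toLp] with p hp
    rw [hp]
    by_cases hpR : p ∈ Metric.closedBall 0 R
    · rw [Set.indicator_of_mem hpR, mul_assoc, ← div_eq_mul_inv]
      refine (hC p).trans (le_mul_of_one_le_right hC0 ?_)
      rw [one_le_div (by positivity)]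
      have : ‖p‖ ≤ R := by simpa using hpR
      gcongr
    · rw [Set.indicator_of_notMem hpR, norm_zero]
      positivity⟩

theorem coeFn_cutoffJT {x : ℝ → R3} (hx : Continuous x) (R : ℝ) :
    ((cutoffJT hx R : HT) : OneParticle) =ᵐ[photonMeasure]
      (Metric.closedBall 0 R).indicator (JT x) :=
  (memLp_indicator_JT hx R).coeFn_toLp

/-- `J_T` is bounded, and the decay of `h` of order `k = 2` is integrable. So the pairing is a
genuine integral although `J_T` need not be square integrable. -/
theorem integrable_inner_JT {x : ℝ → R3} (hx : Continuous x) (h : S) :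
    Integrable (fun p => ⟪JT x p, ((h : HT) : OneParticle) p⟫_ℂ) photonMeasure := by
  obtain ⟨C, hC⟩ := exists_norm_JT_le x
  obtain ⟨D, hD⟩ := h.2 2
  refine (integrable_one_add_sq_inv.const_mul (C * D)).mono'
    ((measurable_JT hx).aestronglyMeasurable.inner (Lp.aestronglyMeasurable _)) ?_
  filter_upwards [hD] with p hp
  refine (norm_inner_le_norm _ _).trans ?_
  rw [mul_assoc]
  exact mul_le_mul (hC p) hp (norm_nonneg _) ((norm_nonneg _).trans (hC p))

theorem inner_cutoffJT {x : ℝ → R3} (hx : Continuous x) (R : ℝ) (h : S) :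
    ⟪(cutoffJT hx R : HT), (h : HT)⟫_ℂ =
      ∫ p in Metric.closedBall 0 R, ⟪JT x p, ((h : HT) : OneParticle) p⟫_ℂ ∂photonMeasure := by
  rw [Submodule.coe_inner, L2.inner_def,
    ← integral_indicator Metric.isClosed_closedBall.measurableSet]
  refine integral_congr_ae ?_
  filter_upwards [coeFn_cutoffJT hx R] with p hp
  rw [hp]
  by_cases hpR : p ∈ Metric.closedBall 0 R
  · rw [Set.indicator_of_mem hpR, Set.indicator_of_mem hpR]
  · rw [Set.indicator_of_notMem hpR, Set.indicator_of_notMem hpR, inner_zero_left]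

theorem tendsto_inner_cutoffJT {x : ℝ → R3} (hx : Continuous x) (h : S) :
    Filter.Tendsto (fun n : ℕ => ⟪(cutoffJT hx n : HT), (h : HT)⟫_ℂ) Filter.atTop
      (nhds (pairing x h)) := by
  simp only [inner_cutoffJT]
  have h1 := tendsto_setIntegral_of_monotone (μ := photonMeasure)
    (f := fun p => ⟪JT x p, ((h : HT) : OneParticle) p⟫_ℂ)
    (s := fun n : ℕ => Metric.closedBall (0 : R3) n)
    (fun n => Metric.isClosed_closedBall.measurableSet)
    (fun m n hmn => Metric.closedBall_subset_closedBall (by exact_mod_cast hmn))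
    (integrable_inner_JT hx h).integrableOn
  rwa [Metric.iUnion_closedBall_nat, setIntegral_univ] at h1

/-- The cutoff current is the test function that detects the divergence: pairing it with `J_T` sees
only the ball on which the two agree. -/
theorem pairing_cutoffJT {x : ℝ → R3} (hx : Continuous x) (R : ℝ) :
    pairing x (cutoffJT hx R) = ((‖cutoffJT hx R‖ ^ 2 : ℝ) : ℂ) := by
  have h1 : ⟪(cutoffJT hx R : HT), (cutoffJT hx R : HT)⟫_ℂ = pairing x (cutoffJT hx R) := by
    rw [Submodule.coe_inner, L2.inner_def, pairing]
    refine integral_congr_ae ?_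
    filter_upwards [coeFn_cutoffJT hx R] with p hp
    rw [hp]
    by_cases hpR : p ∈ Metric.closedBall 0 R
    · rw [Set.indicator_of_mem hpR]
    · rw [Set.indicator_of_notMem hpR, inner_zero_left, inner_zero_right]
  rw [← h1, Complex.ofReal_pow]
  exact inner_self_eq_norm_sq_to_K (𝕜 := ℂ) (cutoffJT hx R : HT)

theorem pairing_smul (x : ℝ → R3) (c : ℂ) (h : S) : pairing x (c • h) = c * pairing x h := by
  rw [pairing, pairing, ← integral_const_mul]
  refine integral_congr_ae ?_
  filter_upwards [Lp.coeFn_smul c ((h : HT) : OneParticle)] with p hp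
  rw [← inner_smul_right]
  exact congrArg _ hp

/-! ### The scattering automorphism -/

/-- The factor `i` turns the imaginary part in the Weyl relations into the real part of `⟪g,h⟫`. -/
theorem conj_weyl {H : Type} [NormedAddCommGroup H] [InnerProductSpace ℂ H]
    (r : ℝ) (g h : H) :
    Fock.weyl (((r : ℂ) * Complex.I) • g) * Fock.weyl h *
        star (Fock.weyl (((r : ℂ) * Complex.I) • g)) =
      Complex.exp (Complex.I * ((r * (⟪g, h⟫_ℂ).re : ℝ) : ℂ)) • Fock.weyl h := by
  have h1 : (⟪((r : ℂ) * Complex.I) • g, h⟫_ℂ).im = -(r * (⟪g, h⟫_ℂ).re) := by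
    rw [inner_smul_left]
    simp
  rw [Fock.weyl_mul_weyl h, smul_mul_assoc, mul_assoc, Fock.weyl_mul_star_weyl, mul_one, h1,
    Complex.ofReal_neg, mul_neg, neg_neg]

/-- The Weyl operator as an element of the unitary group. -/
def weylUnitary (h : HT) : unitary (PhotonFock →L[ℂ] PhotonFock) :=
  ⟨Fock.weyl h, Fock.star_weyl_mul_weyl h, Fock.weyl_mul_star_weyl h⟩

/-- Only a scalar phase varies with `n`, so convergence holds in operator norm even though the
conjugating unitaries themselves need not converge. -/
theorem tendsto_conj_weyl {x : ℝ → R3} (hx : Continuous x) (r : ℝ) (h : S) :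
    Filter.Tendsto (fun n : ℕ =>
      (weylUnitary (((r : ℂ) * Complex.I) • (cutoffJT hx n : HT)) : PhotonFock →L[ℂ] PhotonFock) *
        weylIn h *
        star (weylUnitary (((r : ℂ) * Complex.I) • (cutoffJT hx n : HT)) :
          PhotonFock →L[ℂ] PhotonFock)) Filter.atTop
      (nhds (Complex.exp (Complex.I * ((r * (pairing x h).re : ℝ) : ℂ)) • weylIn h)) := by
  have h2 : Continuous fun z : ℂ =>
      Complex.exp (Complex.I * ((r * z.re : ℝ) : ℂ)) • Fock.weyl (h : HT) := by
    fun_prop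
  exact ((h2.tendsto _).comp (tendsto_inner_cutoffJT hx h)).congr fun n =>
    (conj_weyl r (cutoffJT hx n : HT) (h : HT)).symm

theorem existsUnique_isScatteringAut {x : ℝ → R3} (hx : Continuous x) :
    ∃! α : weylAlgebra ≃⋆ₐ[ℂ] weylAlgebra, IsScatteringAut x α := by
  simp only [isScatteringAut_iff]
  refine existsUnique_starAlgEquiv_of_tendsto (W := weylIn)
    (c := fun h => Complex.exp (Complex.I * ((Real.sqrt 2 * (pairing x h).re : ℝ) : ℂ)))
    (v := fun n => weylUnitary ((((-Real.sqrt 2 : ℝ) : ℂ) * Complex.I) • (cutoffJT hx n : HT)))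
    (fun h => Complex.exp_ne_zero _) (tendsto_conj_weyl hx (Real.sqrt 2)) fun h => ?_
  have h1 := tendsto_conj_weyl hx (-Real.sqrt 2) h
  have h2 : Complex.exp (Complex.I * ((-Real.sqrt 2 * (pairing x h).re : ℝ) : ℂ)) =
      (Complex.exp (Complex.I * ((Real.sqrt 2 * (pairing x h).re : ℝ) : ℂ)))⁻¹ := by
    rw [neg_mul, Complex.ofReal_neg, mul_neg, Complex.exp_neg]
  rwa [h2] at h1

/-! ### Regularity of Fock states -/

theorem norm_vacuum (H : Type) [NormedAddCommGroup H] [InnerProductSpace ℂ H] :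
    ‖Fock.vacuum H‖ = 1 := by
  have h1 : Fock.diagPow (0 : H) 0 ∈ Fock.symmSubspace H 0 :=
    Submodule.le_topologicalClosure _ (Submodule.subset_span ⟨0, rfl⟩)
  have h2 : Fock.symmProj H 0 (Fock.diagPow (0 : H) 0) =
      (⟨Fock.diagPow (0 : H) 0, h1⟩ : Fock.symmSubspace H 0) :=
    Submodule.orthogonalProjectionOnto_mem_subspace_eq_self (K := Fock.symmSubspace H 0) ⟨_, h1⟩
  have h3 : ‖Fock.symmProj H 0 (Fock.diagPow (0 : H) 0)‖ = 1 := by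
    rw [h2]
    exact norm_one (α := ℂ)
  exact (lp.norm_single (p := 2) (by norm_num) 0 _).trans h3

theorem tendsto_inner_weyl (Ψ : PhotonFock) :
    Filter.Tendsto (fun h : S => ⟪Ψ, weylIn h Ψ⟫_ℂ) (nhds 0) (nhds ((‖Ψ‖ ^ 2 : ℝ) : ℂ)) := by
  have h1 : Filter.Tendsto (fun h : S => (h : HT)) (nhds 0) (nhds 0) :=
    continuous_subtype_val.tendsto 0
  have h2 := Filter.Tendsto.inner (𝕜 := ℂ) (tendsto_const_nhds (x := Ψ))
    ((Fock.tendsto_weyl Ψ).comp h1)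
  rw [inner_self_eq_norm_sq_to_K] at h2
  push_cast
  exact h2

/-- Density operators depend continuously on the Weyl operators at the identity. -/
theorem tendsto_of_isFockState {ω : weylAlgebra → ℂ} (hω : IsFockState ω) :
    Filter.Tendsto (fun h : S => ω ⟨weylIn h, weylIn_mem h⟩) (nhds 0) (nhds 1) := by
  obtain ⟨Ψ, hΨ, hω⟩ := hω
  have h1 : ∀ h : S, ω ⟨weylIn h, weylIn_mem h⟩ = ∑' n, ⟪Ψ n, weylIn h (Ψ n)⟫_ℂ :=
    fun h => (hω ⟨weylIn h, weylIn_mem h⟩).tsum_eq.symm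
  have h2 : (1 : ℂ) = ∑' n, ((‖Ψ n‖ ^ 2 : ℝ) : ℂ) := by
    rw [← Complex.ofReal_tsum, hΨ.tsum_eq, Complex.ofReal_one]
  simp only [h1]
  rw [h2]
  -- Weyl operators are isometric, so `‖Ψ n‖²` dominates uniformly in `h`.
  refine tendsto_tsum_of_dominated_convergence hΨ.summable (fun n => tendsto_inner_weyl (Ψ n))
    (Filter.Eventually.of_forall fun h n => ?_)
  refine (norm_inner_le_norm _ _).trans ?_
  rw [weylIn_eq, Fock.norm_weyl_apply, sq]

theorem stateOut_weylIn {x : ℝ → R3} {α : weylAlgebra ≃⋆ₐ[ℂ] weylAlgebra}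
    (hα : IsScatteringAut x α) (h : S) :
    stateOut α ⟨weylIn h, weylIn_mem h⟩ =
      Complex.exp (Complex.I * ((Real.sqrt 2 * (pairing x h).re : ℝ) : ℂ)) *
        ⟪Fock.vacuum HT, weylIn h (Fock.vacuum HT)⟫_ℂ := by
  rw [stateOut, (isScatteringAut_iff x α).mp hα h, ← inner_smul_right]
  rfl

/-- The phase is the quotient of the out and in expectations of `W_in(h)`. Both tend to `1` as `h →
0`, so the real part of the phase is eventually positive. -/
theorem exists_cos_pos {x : ℝ → R3} {α : weylAlgebra ≃⋆ₐ[ℂ] weylAlgebra}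
    (hα : IsScatteringAut x α) (hω : IsFockState (stateOut α)) :
    ∃ δ > 0, ∀ h : S, ‖h‖ < δ → 0 < Real.cos (Real.sqrt 2 * (pairing x h).re) := by
  have h1 := tendsto_of_isFockState hω
  have h2 := tendsto_inner_weyl (Fock.vacuum HT)
  rw [norm_vacuum, one_pow, Complex.ofReal_one] at h2
  have h3 := h1.div h2 one_ne_zero
  rw [div_one] at h3
  have h4 : ∀ᶠ h : S in nhds 0, 0 < Real.cos (Real.sqrt 2 * (pairing x h).re) := by
    filter_upwards [h2.eventually_ne one_ne_zero,
      ((Complex.continuous_re.tendsto 1).comp h3).eventually (lt_mem_nhds (a := 0) (by simp))]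
      with h hne hpos
    simp only [Function.comp_apply, Pi.div_apply, stateOut_weylIn hα, mul_div_cancel_right₀ _ hne,
      mul_comm Complex.I] at hpos
    rwa [Complex.exp_ofReal_mul_I_re] at hpos
  obtain ⟨δ, hδ, hball⟩ := Metric.eventually_nhds_iff.mp h4
  exact ⟨δ, hδ, fun h hh => hball (by rwa [dist_zero_right])⟩

theorem le_of_cos_pos {δ N : ℝ} (hδ : 0 < δ)
    (h : ∀ t : ℝ, 0 ≤ t → t * N < δ → 0 < Real.cos (Real.sqrt 2 * (t * N ^ 2))) :
    N ≤ 4 / δ := by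
  by_contra! hlt
  have hNp : 0 < N := (by positivity : 0 < 4 / δ).trans hlt
  have h2 : 0 < Real.sqrt 2 * N ^ 2 := by positivity
  -- This `t` makes the argument exactly `π/2`, a zero of the cosine; `N > 4/δ` with `π ≤ 4` makes
  -- it admissible.
  have h3 := h (Real.pi / 2 / (Real.sqrt 2 * N ^ 2)) (by positivity) (by
    rw [div_mul_eq_mul_div, div_lt_iff₀ h2]
    have h5 : 4 < N * δ := by rwa [div_lt_iff₀ hδ] at hlt
    have h7 : 1 ≤ Real.sqrt 2 := Real.one_le_sqrt.mpr (by norm_num)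
    calc Real.pi / 2 * N < N * δ * N := by
          gcongr
          linarith [Real.pi_le_four]
      _ = δ * (1 * N ^ 2) := by ring
      _ ≤ δ * (Real.sqrt 2 * N ^ 2) := by gcongr)
  have h4 : Real.sqrt 2 * (Real.pi / 2 / (Real.sqrt 2 * N ^ 2) * N ^ 2) = Real.pi / 2 := by
    have : Real.sqrt 2 ≠ 0 := by positivity
    field_simp
  rw [h4, Real.cos_pi_div_two] at h3
  exact lt_irrefl _ h3

theorem exists_norm_cutoffJT_le {x : ℝ → R3} (hx : Continuous x)
    {α : weylAlgebra ≃⋆ₐ[ℂ] weylAlgebra}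
    (hα : IsScatteringAut x α) (hω : IsFockState (stateOut α)) :
    ∃ K, ∀ R, ‖cutoffJT hx R‖ ≤ K := by
  obtain ⟨δ, hδ, hcos⟩ := exists_cos_pos hα hω
  refine ⟨4 / δ, fun R => le_of_cos_pos hδ fun t ht htN => ?_⟩
  have h1 := hcos ((t : ℂ) • cutoffJT hx R) (by
    have h2 := norm_smul (t : ℂ) (cutoffJT hx R : HT)
    rw [Complex.norm_real, Real.norm_of_nonneg ht] at h2
    exact h2.trans_lt htN)
  rwa [pairing_smul, pairing_cutoffJT, ← Complex.ofReal_mul, Complex.ofReal_re] at h1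

/-- The cutoffs are eventually equal to `J_T` at each point, so Fatou's lemma carries the uniform
norm bound to the limit. -/
theorem memLp_JT_of_norm_cutoffJT_le {x : ℝ → R3} (hx : Continuous x) {K : ℝ}
    (hK : ∀ R, ‖cutoffJT hx R‖ ≤ K) : MemLp (JT x) 2 photonMeasure := by
  have hm := (measurable_JT hx).aestronglyMeasurable (μ := photonMeasure)
  refine ⟨hm, lt_of_le_of_lt ?_ (ENNReal.ofReal_lt_top (r := K))⟩
  have h1 := Lp.eLpNorm_lim_le_liminf_eLpNorm (p := 2) (μ := photonMeasure)
    (f := fun n : ℕ => (Metric.closedBall 0 (n : ℝ)).indicator (JT x))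
    (fun n => (memLp_indicator_JT hx n).1) (JT x) (Filter.Eventually.of_forall fun p => by
      obtain ⟨N, hN⟩ := exists_nat_ge ‖p‖
      refine tendsto_const_nhds.congr' ?_
      filter_upwards [Filter.eventually_ge_atTop N] with n hn
      refine (Set.indicator_of_mem ?_ _).symm
      rw [mem_closedBall_zero_iff]
      exact hN.trans (by exact_mod_cast hn))
  refine h1.trans (Filter.liminf_le_of_frequently_le' (Filter.Frequently.of_forall fun n => ?_))
  have h2 : ‖cutoffJT hx n‖ = _ := Lp.norm_toLp _ (memLp_indicator_JT hx n)
  rw [← ENNReal.ofReal_toReal (memLp_indicator_JT hx n).2.ne, ← h2]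
  exact ENNReal.ofReal_le_ofReal (hK n)

end PointSource

end

/-! ### The theorem -/

theorem mainTheorem2 (x : ℝ → PointSource.R3) (v₀ : ℝ)
    (hcont : Continuous x)
    (hminus : ContDiffOn ℝ 3 x (Set.Iic 0))
    (hplus : ContDiffOn ℝ 3 x (Set.Ici 0))
    (hjump : PointSource.velMinus x ≠ PointSource.velPlus x)
    (hsupp : HasCompactSupport (deriv x))
    (hspeed : ∀ t : ℝ, t ≠ 0 → ‖deriv x t‖ ≤ v₀)
    (hv₀ : v₀ < 1) :
    -- `J_T` does not belong to `ℋ_T`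
    (¬ ∃ h : PointSource.HT,
      ((h : PointSource.OneParticle) : PointSource.R3 → PointSource.C3)
        =ᵐ[PointSource.photonMeasure] PointSource.JT x) ∧
    -- the automorphism that defines `ω_out` exists and is unique, and `ω_out` is not a Fock state
    (∃! α : PointSource.weylAlgebra ≃⋆ₐ[ℂ] PointSource.weylAlgebra,
      PointSource.IsScatteringAut x α) ∧
    (∀ α : PointSource.weylAlgebra ≃⋆ₐ[ℂ] PointSource.weylAlgebra,
      PointSource.IsScatteringAut x α →
        ¬ PointSource.IsFockState (PointSource.stateOut α)) ∧
    -- the divergence is at large momentum only, and is that of the boundary term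
    (∀ R : ℝ, MemLp (PointSource.JT x) 2
      (PointSource.photonMeasure.restrict (Metric.closedBall 0 R))) ∧
    MemLp (fun p => PointSource.JT x p - PointSource.boundaryT x p) 2
      (PointSource.photonMeasure.restrict {p | 1 ≤ ‖p‖}) := by
  have hnot := PointSource.not_memLp_JT hcont hminus hplus hjump hsupp hspeed hv₀
  refine ⟨?_, PointSource.existsUnique_isScatteringAut hcont, ?_,
    PointSource.memLp_JT_closedBall hcont,
    PointSource.memLp_JT_sub_boundaryT hcont hminus hplus hsupp hspeed hv₀⟩
  · rintro ⟨h, hh⟩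
    exact hnot ((Lp.memLp (h : PointSource.OneParticle)).ae_eq hh)
  · intro α hα hω
    obtain ⟨K, hK⟩ := PointSource.exists_norm_cutoffJT_le hcont hα hω
    exact hnot (PointSource.memLp_JT_of_norm_cutoffJT_le hcont hK)
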